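/- Let $\omega=(-1+\sqrt{-11})/2$ and $\mathcal O=\mathcal O_{-11}=\mathbb Z[\omega]$. Let $p$ be an odd rational prime and $\pi\in\mathcal O$ a prime element dividing $p$ (so $p$ may be split, ramified or inert), and put $N=N(\pi)=|\pi|^2$. Let $\Gamma_0(\pi)\subset \mathrm{SL}_2(\mathcal O)$ be the group of matrices whose lower left entry lies in $\langle\pi\rangle$, let $P\Gamma_0(\pi)$ be its image in $\mathrm{PSL}_2(\mathcal O)$, acting on hyperbolic space $\mathbb H^3=\{(z,t): z\in\mathbb C,\ t>0\}$, and let $P\Gamma_\infty$ be the stabilizer of $\infty$ in $P\Gamma_0(\pi)$. The isometric sphere of $\begin{pmatrix}a&b\\c&d\end{pmatrix}\in\Gamma_0(\pi)$, $c\neq0$, is the hemisphere with centre $-d/c$ and radius $1/|c|$. Let $B$ be the set of points on or outside all these isometric spheres. An isometric sphere is said to bound a region $R\subseteq B$ if it contains a point of $R$ that lies on no other isometric sphere, and it is called visible if it bounds $B$. A closed fundamental domain for a group is a set that is the closure of its interior, whose translates cover $\mathbb H^3$, and whose interior is disjoint from its translates by all non-identity elements. Put $$z_1=\tfrac{3+6\omega}{11},\quad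 z_2=\tfrac{-3+5\omega}{11},\quad z_3=\tfrac{8+5\omega}{11},\quad h=\sqrt{\tfrac{2}{11N}},\quad C=\Big\{\pm\tfrac1{\omega\pi},\ \pm\tfrac1{(\omega+1)\pi}\Big\}.$$ Let $J=\{j\in\mathbb Z: |j|\le\frac{p-1}2\}$ if $p$ is split or ramified, and $J=\{j+k\omega: j,k\in\mathbb Z,\ |j|,|k|\le\frac{p-1}2\}$ if $p$ is inert. For $\rho\in J$ let $V_\rho\subset\mathbb C$ be the hexagon that is the convex hull of the six points $(\pm z_i+\rho)/\pi$. Put $F_\infty=\bigcup_{\rho\in J}V_\rho\times(0,\infty)$ and $F=B\cap F_\infty$. Then: 1. The visible spheres are exactly the spheres of radius $1/|\pi|$ centred at $\alpha/\pi$ for $\alpha\in\mathcal O\setminus\langle\pi\rangle$, and the spheres of radius $1/\sqrt{3N}$ centred at $c+\beta$ for $c\in C$, $\beta\in\mathcal O$. The region $B$ is the set of points on or outside all of these spheres. Among the visible spheres of radius $1/\sqrt{3N}$, those whose boundary circle passes through the cusp $0$ are exactly the four with centre in $C$. 2. The vertices of $B$ in $\mathbb H^3$ (the points of $B$ that are not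 interior to a geodesic segment contained in $B$) are exactly the points $\big((\pm z_i+\alpha)/\pi,\,h\big)$ with $i\in\{1,2,3\}$, $\alpha\in\mathcal O$. 3. For every $\alpha\in\mathcal O\setminus\langle\pi\rangle$ there is exactly one $\rho\in J\setminus\{0\}$ such that the sphere of radius $1/|\pi|$ centred at $\alpha/\pi$ is $P\Gamma_\infty$-equivalent to the one of radius $1/|\pi|$ centred at $\rho/\pi$. 4. $F_\infty$ is a closed fundamental domain for $P\Gamma_\infty$, and $F$ is a closed fundamental domain (a Ford domain) for $P\Gamma_0(\pi)$. 5. The isometric spheres that bound $F$ are exactly those of radius $1/|\pi|$ centred at $\rho/\pi$, $\rho\in J\setminus\{0\}$, and the four of radius $1/\sqrt{3N}$ with centre in $C$. The vertices of $B$ lying in $F$ are exactly the points $\big((\pm z_i+\rho)/\pi,\,h\big)$, $\rho\in J$. Moreover $F$ is the union over $\rho\in J$ of the hyperbolic convex hulls of $\infty$ and the six points $\big((\pm z_i+\rho)/\pi,\,h\big)$, with the cusp $0$ added to the hull for $\rho=0$. -/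

import Mathlib

open scoped MatrixGroups ComplexConjugate

noncomputable section

namespace FordDomain

/-! ## The ring of integers `ℤ[ω]` of `ℚ(√-11)` -/

/-- `ω = (-1 + √-11) / 2`. -/
def om : ℂ := ⟨-1 / 2, Real.sqrt 11 / 2⟩

/-- `O₋₁₁ = ℤ[ω]`, as a subring of `ℂ`. -/
abbrev O11 : Subalgebra ℤ ℂ := Algebra.adjoin ℤ {om}

/-! ## Hyperbolic three-space -/

/-- The upper half-space `{(z, t) : z ∈ ℂ, t > 0}`. -/
abbrev H3 : Type := {x : ℂ × ℝ // 0 < x.2}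

/-- The denominator `|cz + d|² + |c|² t²`. -/
def den (g : SL(2, ℂ)) (x : H3) : ℝ :=
  Complex.normSq (g 1 0 * x.1.1 + g 1 1) + Complex.normSq (g 1 0) * x.1.2 ^ 2

/-- The numerator `(az + b) conj(cz + d) + a conj(c) t²`. -/
def num (g : SL(2, ℂ)) (x : H3) : ℂ :=
  (g 0 0 * x.1.1 + g 0 1) * conj (g 1 0 * x.1.1 + g 1 1) +
    g 0 0 * conj (g 1 0) * ((x.1.2 ^ 2 : ℝ) : ℂ)

theorem det_eq (g : SL(2, ℂ)) : g 0 0 * g 1 1 - g 0 1 * g 1 0 = 1 := by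
  have h := g.det_coe
  rwa [Matrix.det_fin_two] at h

theorem den_pos (g : SL(2, ℂ)) (x : H3) : 0 < den g x := by
  have ht : 0 < x.1.2 ^ 2 := pow_pos x.2 2
  unfold den
  by_cases hc : g 1 0 = 0
  · have hd : g 1 1 ≠ 0 := by
      intro hd
      have h := det_eq g
      simp [hc, hd] at h
    have := Complex.normSq_pos.mpr hd
    simpa [hc] using this
  · have h1 := mul_pos (Complex.normSq_pos.mpr hc) ht
    have h2 := Complex.normSq_nonneg (g 1 0 * x.1.1 + g 1 1)
    linarith

/-- The Poincaré extension of a Möbius transformation to upper half-space. -/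
def act (g : SL(2, ℂ)) (x : H3) : H3 :=
  ⟨(num g x / (den g x : ℂ), x.1.2 / den g x), div_pos x.2 (den_pos g x)⟩

theorem den_cast (g : SL(2, ℂ)) (x : H3) :
    (den g x : ℂ) = (g 1 0 * x.1.1 + g 1 1) * conj (g 1 0 * x.1.1 + g 1 1) +
      g 1 0 * conj (g 1 0) * (x.1.2 : ℂ) ^ 2 := by
  rw [Complex.mul_conj, Complex.mul_conj, den]
  push_cast
  rfl

theorem den_mul (g h : SL(2, ℂ)) (x : H3) :
    den (g * h) x = den g (act h x) * den h x := by
  have hD : (den h x : ℂ) ≠ 0 := by exact_mod_cast (den_pos h x).ne'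
  have hdet := det_eq h
  have hdet' := congrArg conj hdet
  simp only [map_sub, map_mul, map_one] at hdet'
  have key : (den (g * h) x : ℂ) = (den g (act h x) : ℂ) * (den h x : ℂ) := by
    rw [den_cast (g * h), den_cast g]
    simp only [act, Complex.ofReal_div, map_add, map_mul, map_div₀, Complex.conj_ofReal]
    field_simp
    rw [den_cast h]
    simp only [num, Matrix.SpecialLinearGroup.coe_mul, Matrix.mul_apply, Fin.sum_univ_two,
      map_add, map_mul, Complex.conj_ofReal, Complex.conj_conj]
    push_cast
    generalize h 0 0 = a at *
    generalize h 0 1 = b at *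
    generalize h 1 0 = c at *
    generalize h 1 1 = d at *
    generalize g 1 0 = u
    generalize g 1 1 = v
    generalize x.1.1 = z
    generalize (x.1.2 : ℂ) = t
    generalize conj a = a' at *
    generalize conj b = b' at *
    generalize conj c = c' at *
    generalize conj d = d' at *
    generalize conj u = u'
    generalize conj v = v'
    generalize conj z = z'
    linear_combination (u * u' * t ^ 2) * ((a' * d' - b' * c') * hdet + hdet')
  exact_mod_cast key

theorem num_mul (g h : SL(2, ℂ)) (x : H3) :
    num (g * h) x = num g (act h x) * (den h x : ℂ) := by
  have hD : (den h x : ℂ) ≠ 0 := by exact_mod_cast (den_pos h x).ne'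
  have hdet := det_eq h
  have hdet' := congrArg conj hdet
  simp only [map_sub, map_mul, map_one] at hdet'
  rw [num, num]
  simp only [act, Complex.ofReal_div, Complex.ofReal_pow, map_add, map_mul, map_div₀,
    Complex.conj_ofReal]
  field_simp
  rw [den_cast h]
  simp only [num, Matrix.SpecialLinearGroup.coe_mul, Matrix.mul_apply, Fin.sum_univ_two,
    map_add, map_mul, Complex.conj_ofReal, Complex.conj_conj]
  push_cast
  generalize h 0 0 = a at *
  generalize h 0 1 = b at *
  generalize h 1 0 = c at *
  generalize h 1 1 = d at *
  generalize g 0 0 = p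
  generalize g 0 1 = q
  generalize g 1 0 = u
  generalize g 1 1 = v
  generalize x.1.1 = z
  generalize (x.1.2 : ℂ) = t
  generalize conj a = a' at *
  generalize conj b = b' at *
  generalize conj c = c' at *
  generalize conj d = d' at *
  generalize conj u = u'
  generalize conj v = v'
  generalize conj z = z'
  linear_combination (p * u' * t ^ 2) * ((a' * d' - b' * c') * hdet + hdet')

instance : MulAction SL(2, ℂ) H3 where
  smul := act
  one_smul x := by
    change act 1 x = x
    apply Subtype.ext
    apply Prod.ext <;> simp [act, num, den]
  mul_smul g h x := by
    change act (g * h) x = act g (act h x)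
    have h1 : (den h x : ℂ) ≠ 0 := by exact_mod_cast (den_pos h x).ne'
    have h2 : (den g (act h x) : ℂ) ≠ 0 := by exact_mod_cast (den_pos g _).ne'
    have h3 := (den_pos h x).ne'
    have h4 := (den_pos g (act h x)).ne'
    apply Subtype.ext
    apply Prod.ext
    · change num (g * h) x / (den (g * h) x : ℂ) = num g (act h x) / (den g (act h x) : ℂ)
      rw [num_mul, den_mul]
      push_cast
      field_simp
    · change x.1.2 / den (g * h) x = x.1.2 / den h x / den g (act h x)
      rw [den_mul]
      field_simp

/-- `SL₂(O₋₁₁)` as a group of permutations of `H3`. -/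
def toPerm : SL(2, O11) →* Equiv.Perm H3 :=
  (MulAction.toPermHom SL(2, ℂ) H3).comp (Matrix.SpecialLinearGroup.map (algebraMap O11 ℂ))

theorem center_le_ker : Subgroup.center SL(2, O11) ≤ toPerm.ker := by
  intro g hg
  obtain ⟨r, hr, hs⟩ := Matrix.SpecialLinearGroup.mem_center_iff.mp hg
  have e00 : g 0 0 = r := by rw [← hs]; simp
  have e01 : g 0 1 = 0 := by rw [← hs]; simp
  have e10 : g 1 0 = 0 := by rw [← hs]; simp
  have e11 : g 1 1 = r := by rw [← hs]; simp
  have hr2 : (r : ℂ) ^ 2 = 1 := by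
    have := congrArg (fun y : O11 => (y : ℂ)) hr
    simpa using this
  have hn : Complex.normSq (r : ℂ) = 1 := by
    have h0 := Complex.normSq_nonneg (r : ℂ)
    have h1 : Complex.normSq (r : ℂ) ^ 2 = 1 := by rw [← map_pow, hr2, map_one]
    nlinarith
  have hrr : (r : ℂ) * conj (r : ℂ) = 1 := by rw [Complex.mul_conj, hn, Complex.ofReal_one]
  rw [MonoidHom.mem_ker]
  ext1 x
  change act (Matrix.SpecialLinearGroup.map (algebraMap O11 ℂ) g) x = x
  have hden : den (Matrix.SpecialLinearGroup.map (algebraMap O11 ℂ) g) x = 1 := by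
    simp [den, e10, e11, hn]
  have hnum : num (Matrix.SpecialLinearGroup.map (algebraMap O11 ℂ) g) x = x.1.1 := by
    simp only [num, Matrix.SpecialLinearGroup.map_apply_coe, RingHom.mapMatrix_apply,
      Matrix.map_apply, e00, e01, e10, e11, Subalgebra.algebraMap_def]
    simp only [map_zero, ZeroMemClass.coe_zero, zero_mul, zero_add, add_zero, mul_zero]
    linear_combination x.1.1 * hrr
  apply Subtype.ext
  apply Prod.ext
  · simp [act, hden, hnum]
  · simp [act, hden]

/-- `PSL₂(O₋₁₁)`, i.e. `SL₂(O₋₁₁)` modulo its centre `{±1}`. -/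
abbrev PSL2O : Type := Matrix.ProjectiveSpecialLinearGroup (Fin 2) O11

/-- The quotient map `SL₂(O₋₁₁) → PSL₂(O₋₁₁)`. -/
def toPSL : SL(2, O11) →* PSL2O := QuotientGroup.mk' _

/-- The action of `PSL₂(O₋₁₁)` on hyperbolic three-space. -/
instance : MulAction PSL2O H3 :=
  MulAction.compHom H3 (QuotientGroup.lift (Subgroup.center SL(2, O11)) toPerm center_le_ker)

/-! ## Congruence subgroups -/

/-- `Γ₀(π)`: the matrices whose lower left entry lies in `⟨π⟩`. -/
def Gamma0 (π : O11) : Subgroup SL(2, O11) where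
  carrier := {g | π ∣ g 1 0}
  one_mem' := by simp
  mul_mem' {g h} hg hh := by
    simp only [Set.mem_ofPred_eq, Matrix.SpecialLinearGroup.coe_mul, Matrix.mul_apply,
      Fin.sum_univ_two] at *
    exact dvd_add (hg.mul_right _) (hh.mul_left _)
  inv_mem' {g} hg := by
    have e : (g⁻¹) 1 0 = -g 1 0 := by simp [Matrix.SpecialLinearGroup.SL2_inv_expl]
    change π ∣ (g⁻¹) 1 0
    rw [e]
    exact (dvd_neg (α := O11)).mpr hg

/-- The matrices of `Γ₀(π)` that fix `∞`, i.e. whose lower left entry is zero. -/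
def GammaInf (π : O11) : Subgroup SL(2, O11) where
  carrier := {g | g ∈ Gamma0 π ∧ g 1 0 = 0}
  one_mem' := ⟨one_mem _, by simp⟩
  mul_mem' {g h} hg hh := by
    refine ⟨mul_mem hg.1 hh.1, ?_⟩
    have h1 := hg.2
    have h2 := hh.2
    simp [Matrix.mul_apply, h1, h2]
  inv_mem' {g} hg := by
    refine ⟨inv_mem hg.1, ?_⟩
    simpa [Matrix.SpecialLinearGroup.SL2_inv_expl] using hg.2

/-- `PΓ₀(π)`, the image of `Γ₀(π)` in `PSL₂(O₋₁₁)`. -/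
def PGamma0 (π : O11) : Subgroup PSL2O := (Gamma0 π).map toPSL

/-- `PΓ_∞`, the stabilizer of `∞` in `PΓ₀(π)`. -/
def PGammaInf (π : O11) : Subgroup PSL2O := (GammaInf π).map toPSL

/-! ## Isometric spheres and the region exterior to them -/

/-- The squared Euclidean distance from `(z, t)` to the boundary point `(c, 0)`. -/
def sqDist (c : ℂ) (x : H3) : ℝ := ‖x.1.1 - c‖ ^ 2 + x.1.2 ^ 2

/-- The hemisphere with centre `c ∈ ℂ` and radius `r`. -/
def hemisphere (c : ℂ) (r : ℝ) : Set H3 := {x | sqDist c x = r ^ 2}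

/-- The closed exterior of `hemisphere c r`. -/
def outside (c : ℂ) (r : ℝ) : Set H3 := {x | r ^ 2 ≤ sqDist c x}

/-- The centre `-d/c` of the isometric sphere of a matrix with rows `(a, b)`, `(c, d)`. -/
def isoCenter (g : SL(2, O11)) : ℂ := -((g 1 1 : O11) : ℂ) / ((g 1 0 : O11) : ℂ)

/-- The radius `1/|c|` of the isometric sphere of a matrix with rows `(a, b)`, `(c, d)`. -/
def isoRadius (g : SL(2, O11)) : ℝ := 1 / ‖((g 1 0 : O11) : ℂ)‖

/-- The isometric spheres of the elements of `PΓ₀(π)` not fixing `∞`. -/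
def isometricSpheres (π : O11) : Set (Set H3) :=
  {S | ∃ g ∈ Gamma0 π, g 1 0 ≠ 0 ∧ S = hemisphere (isoCenter g) (isoRadius g)}

/-- The region `B` exterior to all isometric spheres of `PΓ₀(π)`. -/
def exteriorRegion (π : O11) : Set H3 :=
  {x | ∀ g ∈ Gamma0 π, g 1 0 ≠ 0 → x ∈ outside (isoCenter g) (isoRadius g)}

/-- The isometric spheres of `PΓ₀(π)` that contribute a face to the region `R ⊆ B`: those
containing a point of `R` that lies on no other isometric sphere. -/
def faceSpheres (π : O11) (R : Set H3) : Set (Set H3) :=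
  {S ∈ isometricSpheres π | ∃ x ∈ S ∩ R, ∀ S' ∈ isometricSpheres π, x ∈ S' → S' = S}

/-- The visible spheres. -/
def visibleSpheres (π : O11) : Set (Set H3) := faceSpheres π (exteriorRegion π)

/-! ## Hyperbolic convexity -/

/-- `(z, t) ↦ (z, |z|² + t²)`, on the closed upper half-space `t ≥ 0`: a projective (Klein) model
of hyperbolic three-space, in which geodesics are straight line segments, boundary points `(z, 0)`
lie on the paraboloid `w = |z|²`, and `∞` is the point at infinity in the direction `(0, 1)`. -/
def klein (x : ℂ × ℝ) : ℂ × ℝ := (x.1, ‖x.1‖ ^ 2 + x.2 ^ 2)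

/-- The hyperbolic convex hull of `∞` and a set `P` of points of the closed upper half-space
(a point `(z, 0)` of `P` is an ideal point). -/
def hullWithInfty (P : Set (ℂ × ℝ)) : Set H3 :=
  {x | ∃ w ≤ (klein x.1).2, ((klein x.1).1, w) ∈ convexHull ℝ (klein '' P)}

/-- The vertices in `H3` of a hyperbolically convex region `R`: the points of `R` that are not
interior to a geodesic segment in `R`. -/
def vertices (R : Set H3) : Set H3 :=
  {x | klein x.1 ∈ Set.extremePoints ℝ ((fun y : H3 => klein y.1) '' R)}

/-! ## Fundamental domains -/

/-- `F` is a (closed) fundamental domain for the action of `G` on `X`: it is the closure of its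
interior, its translates cover `X`, and distinct translates have disjoint interiors. -/
structure IsFundamentalRegion (G : Type*) {X : Type*} [Group G] [MulAction G X]
    [TopologicalSpace X] (F : Set X) : Prop where
  closure_interior : closure (interior F) = F
  covers : ∀ x : X, ∃ g : G, g • x ∈ F
  disjoint : ∀ g : G, g ≠ 1 → Disjoint (interior F) ((fun x => g • x) '' interior F)

/-! ## The explicit data -/

/-- The norm `N(π) = |π|²`. -/
def nrm (π : O11) : ℝ := ‖(π : ℂ)‖ ^ 2

/-- The six points `±z₁, ±z₂, ±z₃`, with `z₁ = (3 + 6ω)/11`, `z₂ = (-3 + 5ω)/11` and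
`z₃ = (8 + 5ω)/11`. -/
def sixPoints : Set ℂ :=
  {(3 + 6 * om) / 11, -((3 + 6 * om) / 11), (-3 + 5 * om) / 11, -((-3 + 5 * om) / 11),
    (8 + 5 * om) / 11, -((8 + 5 * om) / 11)}

/-- The centres `±1/(ωπ)`, `±1/((ω+1)π)` of the four small spheres that meet at the cusp `0`. -/
def smallCenters (π : O11) : Set ℂ :=
  {1 / (om * π), -(1 / (om * π)), 1 / ((om + 1) * π), -(1 / ((om + 1) * π))}

/-- The radius `1/√(3 N(π))` of the small spheres. -/
def smallRadius (π : O11) : ℝ := 1 / Real.sqrt (3 * nrm π)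

/-- The common height `√(2/(11 N(π)))` of the vertices. -/
def height (π : O11) : ℝ := Real.sqrt (2 / (11 * nrm π))

/-- The representatives of the residue classes modulo a prime `π` above the odd prime `p`: the
integers `j` with `|j| ≤ (p-1)/2` if `p` splits or ramifies (is not prime in `O₋₁₁`), and the
`j + kω` with `|j|, |k| ≤ (p-1)/2` if `p` is inert (remains prime in `O₋₁₁`). -/
def representatives (p : ℕ) : Set ℂ :=
  {ρ | (¬ Prime (p : O11) ∧ ∃ j : ℤ, 2 * |j| ≤ (p : ℤ) - 1 ∧ ρ = j) ∨
    (Prime (p : O11) ∧ ∃ j k : ℤ, 2 * |j| ≤ (p : ℤ) - 1 ∧ 2 * |k| ≤ (p : ℤ) - 1 ∧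
      ρ = j + k * om)}

/-- The six boundary points `(±zᵢ + ρ)/π`. -/
def cellCorners (π : O11) (ρ : ℂ) : Set ℂ := (fun z => (z + ρ) / (π : ℂ)) '' sixPoints

/-- The part of upper half-space lying vertically over the hexagon with corners `(±zᵢ + ρ)/π`. -/
def column (π : O11) (ρ : ℂ) : Set H3 := {x | x.1.1 ∈ convexHull ℝ (cellCorners π ρ)}

/-- The fundamental domain `F_∞` for `PΓ_∞`: the columns over the hexagons around `ρ/π`, where
`ρ` runs over the representatives. -/
def fundInf (π : O11) (p : ℕ) : Set H3 := ⋃ ρ ∈ representatives p, column π ρ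

/-- The Ford domain `F = B ∩ F_∞`. -/
def fordDomain (π : O11) (p : ℕ) : Set H3 := exteriorRegion π ∩ fundInf π p

/-- The points at height `√(2/(11 N(π)))` above the points `(±zᵢ + ρ)/π`, together with the
cusp `0` if `ρ = 0`. -/
def cellVertices (π : O11) (ρ : ℂ) : Set (ℂ × ℝ) :=
  cellCorners π ρ ×ˢ {height π} ∪ {q | ρ = 0 ∧ q = (0, 0)}

end FordDomain

end

noncomputable section

namespace FordDomain

/-! Put `u = πz` and `w = N(|z|² + t²)`. In these scaled Klein coordinates `H3` is the region above
the paraboloid `w = |u|²`, and being on or outside the isometric sphere of a matrix with lower row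
`(πc, d)` is the affine inequality `herm c d (u, w) ≥ 1`. So `B` becomes the part of a convex set,
`aboveAll`, that lies above the paraboloid. Apart from the coprimality of `πc` and `d`, the
inequalities no longer involve `π`.

The lower boundary of this set is a piecewise linear tent over the Voronoi tiling of `ℤ[ω]` by
hexagons. Three kinds of points satisfy all inequalities. Over a corner of a hexagon, at squared
scaled height `2/11`, every `herm c d` is a positive integer (`herm_corner1`, `herm_corner`). Over
any lattice point height `1` suffices (`high_mem_aboveAll`). Over `α` divisible by `π` the cusp
itself qualifies, because `cα + d` cannot vanish (`cusp_mem_aboveAll`). Cut each hexagon into six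
triangles from its centre. By convexity the flat triangle spanned by two adjacent corners and the
apex over the centre lies in the set. Conversely, one explicit coprime row (`faceRow`) has its plane
through exactly these three points, so nothing below the triangle belongs to the set. This is
`tile_mem`, on which the geometry rests.

If `π ∤ α`, the six triangles around `α` lie in the plane of one sphere of radius `1/|π|`. If `π ∣
α`, two of them belong to large spheres of neighbours and four to small spheres through the cusp.
Visible spheres, vertices and convex hulls are read off from this tent.

The group `PΓ_∞` consists of the translations by `ℤ[ω]`, which become translations by multiples of
`π`. One hexagon per residue class modulo `π` therefore gives `F_∞`. For `PΓ₀(π)`, each orbit has a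
highest point and such a point lies in `B`, while an interior point of `F` cannot be sent into the
interior by an element not fixing `∞`, since it would have to lie on an isometric sphere. -/

/-! ## Arithmetic of `ℤ[ω]` -/

/-- `ω` as an element of `ℤ[ω]`. -/
def omO : O11 := ⟨om, Algebra.subset_adjoin rfl⟩

@[simp] theorem coe_omO : (omO : ℂ) = om := rfl

theorem om_re : om.re = -1 / 2 := rfl

theorem om_im : om.im = √11 / 2 := rfl

theorem sqrt_sq : √11 * √11 = 11 := Real.mul_self_sqrt (by norm_num)

theorem sqrt_pos : 0 < √11 := Real.sqrt_pos.mpr (by norm_num)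

theorem om_mul_self : om * om = -om - 3 := by
  apply Complex.ext
  · simp only [Complex.mul_re, Complex.sub_re, Complex.neg_re, om_re, om_im]
    norm_num
    linear_combination (-1 / 4) * sqrt_sq
  · simp only [Complex.mul_im, Complex.sub_im, Complex.neg_im, om_re, om_im]
    norm_num
    ring

theorem omO_mul_self : omO * omO = -omO - 3 := by
  exact Subtype.ext om_mul_self

theorem conj_om : conj om = -1 - om := by
  apply Complex.ext <;> simp [om_re, om_im]; norm_num

theorem exists_coord (x : O11) : ∃ a b : ℤ, x = a + b * omO := by
  obtain ⟨x, hx⟩ := x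
  suffices h : ∃ a b : ℤ, x = a + b * om by
    obtain ⟨a, b, h⟩ := h
    exact ⟨a, b, Subtype.ext (by simpa using h)⟩
  induction hx using Algebra.adjoin_induction with
  | mem x hx => exact ⟨0, 1, by simpa using hx⟩
  | algebraMap r => exact ⟨r, 0, by simp⟩
  | add x y _ _ hx hy =>
    obtain ⟨a, b, rfl⟩ := hx
    obtain ⟨c, d, rfl⟩ := hy
    exact ⟨a + c, b + d, by push_cast; ring⟩
  | mul x y _ _ hx hy =>
    obtain ⟨a, b, rfl⟩ := hx
    obtain ⟨c, d, rfl⟩ := hy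
    refine ⟨a * c - 3 * b * d, a * d + b * c - b * d, ?_⟩
    push_cast
    linear_combination (b * d : ℂ) * om_mul_self

theorem coord_inj {a b c d : ℤ} (h : (a + b * om : ℂ) = c + d * om) : a = c ∧ b = d := by
  have h1 := congrArg Complex.im h
  simp [om_im, om_re, sqrt_pos.ne'] at h1
  subst h1
  simpa using h

/-- Complex conjugation on `ℤ[ω]`. -/
def conjO (x : O11) : O11 := ⟨conj (x : ℂ), by
  obtain ⟨a, b, rfl⟩ := exists_coord x
  have : conj ((a + b * omO : O11) : ℂ) = ((a + b * (-1 - omO) : O11) : ℂ) := by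
    simp [conj_om]
  rw [this]
  exact Subtype.property _⟩

theorem normSq_coord (a b : ℤ) :
    Complex.normSq ((a + b * om : ℂ)) = ((a ^ 2 - a * b + 3 * b ^ 2 : ℤ) : ℝ) := by
  simp [Complex.normSq_apply, om_re, om_im]
  linear_combination (b ^ 2 / 4 : ℝ) * sqrt_sq

theorem normSq_om : Complex.normSq om = 3 := by
  simpa using normSq_coord 0 1

theorem normSq_om_add_one : Complex.normSq (om + 1) = 3 := by
  have := normSq_coord 1 1
  simp only [Int.cast_one, one_mul] at this
  rw [add_comm, this]
  norm_num

theorem om_ne_zero : om ≠ 0 := by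
  intro h
  have := normSq_om
  simp [h] at this

theorem om_add_one_ne_zero : om + 1 ≠ 0 := by
  intro h
  have := normSq_om_add_one
  simp [h] at this

theorem exists_normSq_eq (x : O11) : ∃ n : ℤ, Complex.normSq (x : ℂ) = n := by
  obtain ⟨a, b, rfl⟩ := exists_coord x
  exact ⟨_, normSq_coord a b⟩

/-- The discreteness principle behind all lower bounds: it is applied to norms and, in
`herm_corner1`, to values of `herm`. -/
theorem one_le_of_int {r : ℝ} (h : ∃ n : ℤ, r = n) (hr : 0 < r) : 1 ≤ r := by
  obtain ⟨n, rfl⟩ := h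
  exact_mod_cast hr

theorem one_le_normSq {x : O11} (hx : x ≠ 0) : 1 ≤ Complex.normSq (x : ℂ) :=
  one_le_of_int (exists_normSq_eq x) (Complex.normSq_pos.mpr (by simpa using hx))

theorem eq_of_normSq_eq_one {x : O11} (hx : Complex.normSq (x : ℂ) = 1) : x = 1 ∨ x = -1 := by
  obtain ⟨a, b, rfl⟩ := exists_coord x
  have h := normSq_coord a b
  simp only [AddMemClass.coe_add, MulMemClass.coe_mul, SubringClass.coe_intCast, coe_omO] at hx
  rw [hx] at h
  have h' : a ^ 2 - a * b + 3 * b ^ 2 = 1 := by exact_mod_cast h.symm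
  have hb : b = 0 := by
    -- The norm form satisfies `4(a² - ab + 3b²) = (2a - b)² + 11b²`.
    have : b ^ 2 < 1 := by nlinarith [sq_nonneg (2 * a - b)]
    have := sq_nonneg b
    exact pow_eq_zero_iff (two_ne_zero) |>.mp (by omega)
  subst hb
  have : (a - 1) * (a + 1) = 0 := by linarith
  rcases mul_eq_zero.mp this with h | h
  · left; simp [show a = 1 by omega]
  · right; simp [show a = -1 by omega]

theorem eq_of_normSq_eq_three {x : O11} (hx : Complex.normSq (x : ℂ) = 3) :
    x = omO ∨ x = -omO ∨ x = omO + 1 ∨ x = -(omO + 1) := by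
  obtain ⟨a, b, rfl⟩ := exists_coord x
  have h := normSq_coord a b
  simp only [AddMemClass.coe_add, MulMemClass.coe_mul, SubringClass.coe_intCast, coe_omO] at hx
  rw [hx] at h
  have h' : a ^ 2 - a * b + 3 * b ^ 2 = 3 := by exact_mod_cast h.symm
  have hb1 : b ≤ 1 := by nlinarith [sq_nonneg (2 * a - b)]
  have hb2 : -1 ≤ b := by nlinarith [sq_nonneg (2 * a - b)]
  interval_cases b
  · have : a * (a + 1) = 0 := by linarith
    rcases mul_eq_zero.mp this with h | h
    · right; left; simp [h]
    · right; right; right; simp [show a = -1 by omega]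
  · have : a ^ 2 = 3 := by linarith
    have h1 : a ≤ 1 := by nlinarith
    have h2 : -1 ≤ a := by nlinarith
    interval_cases a <;> omega
  · have : a * (a - 1) = 0 := by linarith
    rcases mul_eq_zero.mp this with h | h
    · left; simp [h]
    · right; right; left; simp [show a = 1 by omega]; ring

theorem isUnit_of_normSq_eq_one {x : O11} (hx : Complex.normSq (x : ℂ) = 1) : IsUnit x := by
  rcases eq_of_normSq_eq_one hx with rfl | rfl <;> simp

theorem eq_of_mul_eq_one {x y : O11} (h : x * y = 1) : x = 1 ∧ y = 1 ∨ x = -1 ∧ y = -1 := by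
  have hx : x ≠ 0 := by rintro rfl; simp at h
  have hy : y ≠ 0 := by rintro rfl; simp at h
  have h1 := one_le_normSq hx
  have h2 := one_le_normSq hy
  have h3 : Complex.normSq (x : ℂ) * Complex.normSq (y : ℂ) = 1 := by
    rw [← map_mul, ← MulMemClass.coe_mul, h]; simp
  rcases eq_of_normSq_eq_one (x := x) (by nlinarith) with rfl | rfl
  · left; simpa using h
  · right; simpa [neg_eq_iff_eq_neg] using h

theorem finite_norm_le (R : ℝ) : {x : O11 | ‖(x : ℂ)‖ ≤ R}.Finite := by
  obtain ⟨m, hm⟩ := exists_nat_gt (4 * R ^ 2)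
  refine ((Set.finite_Icc (-(m : ℤ)) m).prod (Set.finite_Icc (-(m : ℤ)) m)
    |>.image (fun q : ℤ × ℤ => (q.1 + q.2 * omO : O11))).subset ?_
  intro x hx
  obtain ⟨a, b, rfl⟩ := exists_coord x
  refine ⟨(a, b), ?_, rfl⟩
  have h := normSq_coord a b
  have hx' : Complex.normSq (a + b * om : ℂ) ≤ R ^ 2 := by
    rw [Complex.normSq_eq_norm_sq]
    exact pow_le_pow_left₀ (norm_nonneg _) (by simpa using hx) 2
  rw [h] at hx'
  have h4 : 4 * (a ^ 2 - a * b + 3 * b ^ 2) < (m : ℤ) := by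
    have : ((4 * (a ^ 2 - a * b + 3 * b ^ 2) : ℤ) : ℝ) < ((m : ℤ) : ℝ) := by
      push_cast at hx' ⊢; linarith
    exact_mod_cast this
  have hb : b ^ 2 ≤ m := by nlinarith [sq_nonneg (2 * a - b)]
  -- Here the other completion of the square is used: `12(a² - ab + 3b²) = (a - 6b)² + 11a²`.
  have ha : a ^ 2 ≤ m := by nlinarith [sq_nonneg (a - 6 * b)]
  have key : ∀ c : ℤ, c ^ 2 ≤ m → -(m : ℤ) ≤ c ∧ c ≤ m := by
    intro c hc
    constructor
    · nlinarith [sq_nonneg (c + 1), sq_nonneg c]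
    · nlinarith [sq_nonneg (c - 1), sq_nonneg c]
  exact ⟨key a ha, key b hb⟩

/-! ## The Voronoi cell of `ℤ[ω]` -/

/-- The Voronoi cell of `ℤ[ω]`. -/
def Hex (u : ℂ) : Prop := |2 * u.re| ≤ 1 ∧ |√11 * u.im - u.re| ≤ 3 ∧ |√11 * u.im + u.re| ≤ 3

/-- A nearest lattice point `α` works. The inequalities in `Hex` say that `u - α` is no closer to
`±1`, `±ω`, `±(ω + 1)` than to `0`. -/
theorem exists_hex (u : ℂ) : ∃ α : O11, Hex (u - α) := by
  have hfin : {α : O11 | ‖u - α‖ ≤ ‖u‖}.Finite := by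
    refine (finite_norm_le (2 * ‖u‖)).subset fun α hα => ?_
    have h1 := norm_sub_norm_le (α : ℂ) u
    rw [norm_sub_rev] at h1
    simp only [Set.mem_ofPred_eq] at *
    linarith
  obtain ⟨α, hα, hmin⟩ := Set.exists_min_image _ (fun α : O11 => ‖u - α‖) hfin ⟨0, by simp⟩
  have hmin' : ∀ β : O11, ‖u - α‖ ≤ ‖u - (α + β : O11)‖ := by
    intro β
    by_cases h : ‖u - (α + β : O11)‖ ≤ ‖u‖
    · exact hmin _ h
    · exact (show ‖u - α‖ ≤ ‖u‖ from hα).trans (not_le.mp h).le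
  refine ⟨α, ?_⟩
  have key : ∀ β : O11, 2 * ((u - α) * conj (β : ℂ)).re ≤ Complex.normSq (β : ℂ) := by
    intro β
    have h := pow_le_pow_left₀ (norm_nonneg _) (hmin' β) 2
    rw [← Complex.normSq_eq_norm_sq, ← Complex.normSq_eq_norm_sq, AddMemClass.coe_add,
      ← sub_sub, Complex.normSq_sub (u - α)] at h
    linarith
  have k1 := key 1
  have k2 := key (-1)
  have k3 := key omO
  have k4 := key (-omO)
  have k5 := key (omO + 1)
  have k6 := key (-(omO + 1))
  push_cast at k1 k2 k3 k4 k5 k6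
  simp only [Complex.normSq_neg, coe_omO, normSq_om, normSq_om_add_one, map_neg] at *
  generalize u - α = v at *
  simp [om_re, om_im] at k1 k2 k3 k4 k5 k6
  simp only [Hex, abs_le]
  refine ⟨⟨?_, ?_⟩, ⟨?_, ?_⟩, ?_, ?_⟩ <;> linarith

theorem Hex.normSq_lt_one {u : ℂ} (hu : Hex u) : Complex.normSq u < 1 := by
  obtain ⟨h1, h2, h3⟩ := hu
  obtain ⟨X, y⟩ := u
  rw [abs_le] at h1 h2 h3
  dsimp only at *
  rw [Complex.normSq_mk]
  have hy : y * y = (√11 * y) ^ 2 / 11 := by linear_combination (-y ^ 2 / 11) * sqrt_sq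
  rw [hy]
  generalize √11 * y = Y at *
  have h4 : |Y| ≤ 3 - |X| := by
    rcases abs_cases X with h | h <;> rcases abs_cases Y with k | k <;> linarith
  have h5 : |X| ≤ 1 / 2 := abs_le.mpr ⟨by linarith, by linarith⟩
  have h6 := abs_nonneg X
  rw [← abs_mul_abs_self X, ← sq_abs Y]
  -- The bound `X² + (3 - |X|)²/11` is convex in `|X|` and equals `9/11` at both ends of `[0, 1/2]`.
  nlinarith [abs_nonneg Y]

/-- Division with remainder: the Voronoi cell lies inside the open unit disc. The instance makes `π`
and `α` coprime whenever `π ∤ α`, so that every large sphere really is isometric. -/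
instance : IsPrincipalIdealRing O11 where
  principal I := by
    by_cases hI : I = ⊥
    · exact hI ▸ bot_isPrincipal
    obtain ⟨x₀, hx₀, hx₀0⟩ := Submodule.exists_mem_ne_zero_of_ne_bot hI
    obtain ⟨δ, ⟨hδI, hδ0, hδ⟩, hmin⟩ := Set.exists_min_image
      {x : O11 | x ∈ I ∧ x ≠ 0 ∧ ‖(x : ℂ)‖ ≤ ‖(x₀ : ℂ)‖} (fun x : O11 => ‖(x : ℂ)‖)
      ((finite_norm_le ‖(x₀ : ℂ)‖).subset fun x hx => hx.2.2) ⟨x₀, hx₀, hx₀0, le_rfl⟩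
    refine ⟨δ, le_antisymm ?_ ((Ideal.span_singleton_le_iff_mem I).mpr hδI)⟩
    intro x hx
    have hδ0' : (δ : ℂ) ≠ 0 := by simpa using hδ0
    obtain ⟨q, hq⟩ := exists_hex (x / δ : ℂ)
    have hlt := hq.normSq_lt_one
    by_contra hxδ
    have hr0 : x - q * δ ≠ 0 := by
      intro h0
      rw [sub_eq_zero] at h0
      exact hxδ (h0 ▸ Ideal.mem_span_singleton'.mpr ⟨q, rfl⟩)
    have hnorm : ‖((x - q * δ : O11) : ℂ)‖ < ‖(δ : ℂ)‖ := by
      have e : ((x - q * δ : O11) : ℂ) = (x / δ - q) * δ := by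
        push_cast
        field_simp
      rw [e, norm_mul]
      rw [Complex.normSq_eq_norm_sq] at hlt
      have h1 : ‖(x / δ - q : ℂ)‖ < 1 := by nlinarith [norm_nonneg (x / δ - q : ℂ)]
      exact mul_lt_of_lt_one_left (norm_pos_iff.mpr hδ0') h1
    exact hnorm.not_ge (hmin _ ⟨I.sub_mem hx (I.mul_mem_left q hδI), hr0, hnorm.le.trans hδ⟩)

/-! ## Isometric spheres as affine functions in scaled Klein coordinates -/

/-- The affine function `|c|² w + 2 Re(c u d̄) + |d|²` of `(u, w)`. With `w = |u|² + s` it is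
`|c u + d|² + |c|² s`. -/
def herm (c d : ℂ) (P : ℂ × ℝ) : ℝ :=
  Complex.normSq c * P.2 + 2 * (c * P.1 * conj d).re + Complex.normSq d

theorem herm_lift (c d u : ℂ) (s : ℝ) :
    herm c d (u, Complex.normSq u + s) = Complex.normSq (c * u + d) + Complex.normSq c * s := by
  simp only [herm, Complex.normSq_add, map_mul]
  ring

theorem herm_combo (c d : ℂ) (P Q : ℂ × ℝ) {a b : ℝ} (h : a + b = 1) :
    herm c d (a • P + b • Q) = a * herm c d P + b * herm c d Q := by
  obtain rfl : b = 1 - a := by linarith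
  simp [herm]
  ring

theorem continuous_herm (c d : ℂ) : Continuous (herm c d) := by
  unfold herm
  fun_prop

/-- The affine map of Klein coordinates induced by `u ↦ α + ε u`. -/
def rel (α : ℂ) (ε : ℤ) (P : ℂ × ℝ) : ℂ × ℝ :=
  (α + ε * P.1, Complex.normSq α + 2 * ε * (P.1 * conj α).re + P.2)

theorem rel_lift (α u : ℂ) {ε : ℤ} (hε : ε = 1 ∨ ε = -1) (s : ℝ) :
    rel α ε (u, Complex.normSq u + s) = (α + ε * u, Complex.normSq (α + ε * u) + s) := by
  rcases hε with rfl | rfl <;> simp [rel, Complex.normSq_apply] <;> ring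

/-- Substituting `α + εu` for `u` replaces the row `(c, d)` by `(c, ε(d + cα))`, again with entries
in `ℤ[ω]` when `α` is. Computations near any lattice point thus reduce to computations near `0`. -/
theorem herm_rel (c d α : ℂ) {ε : ℤ} (hε : ε = 1 ∨ ε = -1) (P : ℂ × ℝ) :
    herm c d (rel α ε P) = herm c (ε * (d + c * α)) P := by
  rcases hε with rfl | rfl <;> simp [rel, herm, Complex.normSq_apply] <;> ring

theorem herm_rel' (c d α : ℂ) {ε : ℤ} (hε : ε = 1 ∨ ε = -1) (P : ℂ × ℝ) :
    herm c (-c * α + ε * d) (rel α ε P) = herm c d P := by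
  rw [herm_rel _ _ _ hε]
  congr 1
  rcases hε with rfl | rfl <;> push_cast <;> ring

/-- The points of the Klein model lying above all planes that belong to the rows `(π c, d)`. -/
def aboveAll (π : O11) : Set (ℂ × ℝ) :=
  {P | ∀ c d : O11, c ≠ 0 → IsCoprime (π * c) d → 1 ≤ herm c d P}

/-- Klein coordinates scaled by `π`. -/
def scaled (π : O11) (x : H3) : ℂ × ℝ :=
  (π * x.1.1, nrm π * (‖x.1.1‖ ^ 2 + x.1.2 ^ 2))

theorem nrm_eq (π : O11) : nrm π = Complex.normSq (π : ℂ) := by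
  rw [nrm, Complex.normSq_eq_norm_sq]

theorem scaled_eq (π : O11) (x : H3) :
    scaled π x = (π * x.1.1, Complex.normSq (π * x.1.1) + nrm π * x.1.2 ^ 2) := by
  rw [scaled, nrm_eq, map_mul, Complex.normSq_eq_norm_sq x.1.1, mul_add]

theorem den_eq_herm (π c d : O11) (g : SL(2, O11)) (hc : g 1 0 = π * c) (hd : g 1 1 = d) (x : H3) :
    den (Matrix.SpecialLinearGroup.map (algebraMap O11 ℂ) g) x = herm c d (scaled π x) := by
  rw [scaled_eq, herm_lift]
  have h1 : (Matrix.SpecialLinearGroup.map (algebraMap O11 ℂ) g) 1 0 = (π * c : ℂ) := by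
    simp [hc]
  have h2 : (Matrix.SpecialLinearGroup.map (algebraMap O11 ℂ) g) 1 1 = (d : ℂ) := by
    simp [hd]
  rw [den, h1, h2, nrm_eq, map_mul]
  rw [show (π * c * x.1.1 + d : ℂ) = c * (π * x.1.1) + d by ring]
  ring

theorem isCoprime_row (g : SL(2, O11)) : IsCoprime (g 1 0) (g 1 1) := by
  have h := g.det_coe
  rw [Matrix.det_fin_two] at h
  exact ⟨-g 0 1, g 0 0, by linear_combination h⟩

theorem exists_row {c d : O11} (h : IsCoprime c d) : ∃ g : SL(2, O11), g 1 0 = c ∧ g 1 1 = d := by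
  obtain ⟨a, b, h⟩ := h
  exact ⟨⟨!![b, -a; c, d], by rw [Matrix.det_fin_two_of]; linear_combination h⟩, rfl, rfl⟩

/-- The sphere that belongs to the row `(π c, d)`. -/
def rowSphere (π c d : O11) : Set H3 :=
  hemisphere (-(d : ℂ) / (π * c : ℂ)) (1 / ‖(π * c : ℂ)‖)

theorem sqDist_eq (π c d : O11) (hπ : π ≠ 0) (hc : c ≠ 0) (x : H3) :
    sqDist (-(d : ℂ) / (π * c : ℂ)) x =
      herm c d (scaled π x) * (1 / ‖(π * c : ℂ)‖) ^ 2 := by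
  have h1 : (π : ℂ) ≠ 0 := by simpa using hπ
  have h2 : (c : ℂ) ≠ 0 := by simpa using hc
  have h3 : ‖(π : ℂ)‖ ≠ 0 := by simpa using hπ
  have h4 : ‖(c : ℂ)‖ ≠ 0 := by simpa using hc
  rw [scaled_eq, herm_lift, sqDist, nrm, Complex.normSq_eq_norm_sq, Complex.normSq_eq_norm_sq,
    show x.1.1 - -(d : ℂ) / (π * c) = (c * (π * x.1.1) + d) / (π * c) by field_simp; ring,
    norm_div, norm_mul]
  field_simp

theorem radius_pos {π c : O11} (hπ : π ≠ 0) (hc : c ≠ 0) : 0 < 1 / ‖(π * c : ℂ)‖ := by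
  have h1 : (π : ℂ) ≠ 0 := by simpa using hπ
  have h2 : (c : ℂ) ≠ 0 := by simpa using hc
  have := norm_pos_iff.mpr (mul_ne_zero h1 h2)
  positivity

theorem mem_rowSphere {π c d : O11} (hπ : π ≠ 0) (hc : c ≠ 0) {x : H3} :
    x ∈ rowSphere π c d ↔ herm c d (scaled π x) = 1 := by
  have := pow_pos (radius_pos hπ hc) 2
  rw [rowSphere, hemisphere, Set.mem_ofPred_eq, sqDist_eq π c d hπ hc]
  exact mul_eq_right₀ this.ne'

theorem mem_outside_row {π c d : O11} (hπ : π ≠ 0) (hc : c ≠ 0) {x : H3} :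
    x ∈ outside (-(d : ℂ) / (π * c : ℂ)) (1 / ‖(π * c : ℂ)‖) ↔ 1 ≤ herm c d (scaled π x) := by
  have := pow_pos (radius_pos hπ hc) 2
  rw [outside, Set.mem_ofPred_eq, sqDist_eq π c d hπ hc]
  exact le_mul_iff_one_le_left this

theorem mem_isometricSpheres {π : O11} (hπ : π ≠ 0) {S : Set H3} :
    S ∈ isometricSpheres π ↔
      ∃ c d : O11, c ≠ 0 ∧ IsCoprime (π * c) d ∧ S = rowSphere π c d := by
  constructor
  · rintro ⟨g, ⟨c, hc⟩, h0, rfl⟩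
    refine ⟨c, g 1 1, ?_, ?_, ?_⟩
    · rintro rfl
      exact h0 (by simpa using hc)
    · rw [← hc]
      exact isCoprime_row g
    · rw [rowSphere, isoCenter, isoRadius, hc, MulMemClass.coe_mul]
  · rintro ⟨c, d, hc, hcd, rfl⟩
    obtain ⟨g, h1, h2⟩ := exists_row hcd
    refine ⟨g, ⟨c, h1⟩, ?_, ?_⟩
    · rw [h1]
      exact mul_ne_zero hπ hc
    · rw [rowSphere, isoCenter, isoRadius, h1, h2, MulMemClass.coe_mul]

theorem mem_exteriorRegion {π : O11} (hπ : π ≠ 0) {x : H3} :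
    x ∈ exteriorRegion π ↔ scaled π x ∈ aboveAll π := by
  constructor
  · intro hx c d hc hcd
    obtain ⟨g, h1, h2⟩ := exists_row hcd
    have := hx g ⟨c, h1⟩ (by rw [h1]; exact mul_ne_zero hπ hc)
    rw [isoCenter, isoRadius, h1, h2, MulMemClass.coe_mul] at this
    exact (mem_outside_row hπ hc).mp this
  · rintro hx g ⟨c, hc⟩ h0
    have hc0 : c ≠ 0 := by
      rintro rfl
      exact h0 (by simpa using hc)
    have := hx c (g 1 1) hc0 (hc ▸ isCoprime_row g)
    rw [isoCenter, isoRadius, hc, MulMemClass.coe_mul]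
    exact (mem_outside_row hπ hc0).mpr this

/-- The top of each hemisphere lies on the other, which gives `r² + |c - c'|² = r'²` and the same
with `r`, `r'` exchanged. -/
theorem hemisphere_inj {c c' : ℂ} {r r' : ℝ} (hr : 0 < r) (hr' : 0 < r')
    (h : hemisphere c r = hemisphere c' r') : c = c' ∧ r = r' := by
  have h1 : (⟨(c, r), hr⟩ : H3) ∈ hemisphere c' r' := h ▸ by simp [hemisphere, sqDist]
  have h2 : (⟨(c', r'), hr'⟩ : H3) ∈ hemisphere c r := h ▸ by simp [hemisphere, sqDist]
  simp only [hemisphere, sqDist, Set.mem_ofPred_eq] at h1 h2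
  rw [norm_sub_rev] at h2
  have h3 : ‖c - c'‖ ^ 2 = 0 := by nlinarith [sq_nonneg ‖c - c'‖]
  refine ⟨by simpa [sub_eq_zero] using h3, ?_⟩
  rw [h3] at h1
  nlinarith

/-! ## Corners, tops and cusps lie above all planes -/

theorem aboveAll_mono {π : O11} {u : ℂ} {w w' : ℝ} (hw : w ≤ w') (h : (u, w) ∈ aboveAll π) :
    (u, w') ∈ aboveAll π := by
  intro c d hc hcd
  refine (h c d hc hcd).trans ?_
  unfold herm
  have := mul_le_mul_of_nonneg_left hw (Complex.normSq_nonneg (c : ℂ))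
  dsimp only
  linarith

theorem convex_aboveAll (π : O11) : Convex ℝ (aboveAll π) := by
  intro P hP Q hQ a b ha hb hab c d hc hcd
  rw [herm_combo _ _ _ _ hab]
  nlinarith [hP c d hc hcd, hQ c d hc hcd]

theorem isClosed_aboveAll (π : O11) : IsClosed (aboveAll π) := by
  have : aboveAll π = ⋂ (c : O11) (d : O11) (_ : c ≠ 0) (_ : IsCoprime (π * c) d),
      {P | 1 ≤ herm c d P} := by
    ext P
    simp [aboveAll]
  rw [this]
  exact isClosed_iInter fun c => isClosed_iInter fun d => isClosed_iInter fun _ =>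
    isClosed_iInter fun _ => isClosed_le continuous_const (continuous_herm _ _)

theorem high_mem_aboveAll (π : O11) {u : ℂ} {w : ℝ} (h : Complex.normSq u + 1 ≤ w) :
    (u, w) ∈ aboveAll π := by
  refine aboveAll_mono h fun c d hc _ => ?_
  rw [herm_lift]
  have := one_le_normSq hc
  have := Complex.normSq_nonneg (c * u + d)
  linarith

/-- If `cα + d` vanished, `π` would divide `d` as well as `πc`, against coprimality. So its norm is
at least `1`. -/
theorem cusp_mem_aboveAll {π α : O11} (hπ : Prime π) (h : π ∣ α) :
    ((α : ℂ), Complex.normSq (α : ℂ)) ∈ aboveAll π := by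
  intro c d hc hcd
  have h1 := herm_lift c d α 0
  rw [add_zero, mul_zero, add_zero] at h1
  rw [h1]
  have : c * α + d ≠ 0 := by
    intro h0
    have hd : π ∣ d := by
      rw [← dvd_add_right (h.mul_left c), h0]
      exact dvd_zero π
    exact hπ.not_isUnit (hcd.isUnit_of_dvd' (dvd_mul_right π c) hd)
  simpa using one_le_normSq this

/-- A corner of the Voronoi cell of `ℤ[ω]`. -/
def corner1 : ℂ := (3 + 6 * om) / 11

/-- A corner of the Voronoi cell of `ℤ[ω]`. -/
def corner2 : ℂ := (-3 + 5 * om) / 11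

/-- A corner of the Voronoi cell of `ℤ[ω]`. -/
def corner3 : ℂ := (8 + 5 * om) / 11

theorem corner1_eq : corner1 = ⟨0, 3 * √11 / 11⟩ := by
  apply Complex.ext
  · simp [corner1, om_re, om_im]; norm_num
  · simp [corner1, om_re, om_im]; ring

theorem corner2_eq : corner2 = -corner1 + om := by
  simp only [corner1, corner2]
  ring

theorem corner3_eq : corner3 = -corner1 + (om + 1) := by
  simp only [corner1, corner3]
  ring

/-- The arithmetic core: at this point `herm c d` takes integer values, and it is positive because
the point lies `2/11` above the paraboloid. Coprimality plays no role. -/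
theorem herm_corner1 {c : O11} (hc : c ≠ 0) (d : O11) : 1 ≤ herm c d (corner1, 1) := by
  have h1 : (1 : ℝ) = Complex.normSq corner1 + 2 / 11 := by
    rw [corner1_eq, Complex.normSq_mk]
    linear_combination (-9 / 121) * sqrt_sq
  apply one_le_of_int
  · obtain ⟨a, b, rfl⟩ := exists_coord c
    obtain ⟨e, f, rfl⟩ := exists_coord d
    refine ⟨(a ^ 2 - a * b + 3 * b ^ 2) + (e ^ 2 - e * f + 3 * f ^ 2) - 3 * (b * e - a * f), ?_⟩
    have h2 := normSq_coord a b
    have h3 := normSq_coord e f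
    simp only [herm, AddMemClass.coe_add, MulMemClass.coe_mul, SubringClass.coe_intCast,
      coe_omO, h2, h3, corner1_eq]
    simp [om_re, om_im]
    linear_combination (3 / 11 : ℝ) * (a * f - b * e) * sqrt_sq
  · have h4 : herm c d (corner1, 1) =
        Complex.normSq (c * corner1 + d) + Complex.normSq (c : ℂ) * (2 / 11) := by
      rw [← herm_lift, ← h1]
    rw [h4]
    have := one_le_normSq hc
    have := Complex.normSq_nonneg (c * corner1 + d)
    linarith

theorem corner2_coord : corner2 = ⟨-1 / 2, 5 * √11 / 22⟩ := by
  rw [corner2_eq, corner1_eq]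
  apply Complex.ext <;> simp [om_re, om_im]; ring

theorem corner3_coord : corner3 = ⟨1 / 2, 5 * √11 / 22⟩ := by
  rw [corner3_eq, corner1_eq]
  apply Complex.ext <;> simp [om_re, om_im] <;> ring

/-- The symmetries `u ↦ β ± u` of the lattice permute the corners of the tiling transitively, so it
suffices to study `corner1`. -/
theorem exists_rel_corner1 {v : ℂ} (hv : v ∈ sixPoints) :
    ∃ (β : O11) (δ : ℤ), (δ = 1 ∨ δ = -1) ∧ (v, (1 : ℝ)) = rel β δ (corner1, 1) := by
  have h2 : (corner2, (1 : ℝ)) = rel omO (-1) (corner1, 1) := by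
    rw [rel, corner2_eq, coe_omO, normSq_om, corner1_eq]
    refine Prod.ext (by simp [add_comm]) ?_
    simp [om_re, om_im]
    linear_combination (-3 / 11) * sqrt_sq
  have h3 : (corner3, (1 : ℝ)) = rel (omO + 1 : O11) (-1) (corner1, 1) := by
    rw [rel, corner3_eq]
    push_cast
    rw [coe_omO, normSq_om_add_one, corner1_eq]
    refine Prod.ext (by simp; ring) ?_
    simp [om_re, om_im]
    linear_combination (-3 / 11) * sqrt_sq
  have neg : ∀ {w : ℂ} {β : O11}, (w, (1 : ℝ)) = rel β (-1) (corner1, 1) →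
      (-w, (1 : ℝ)) = rel (-β : O11) 1 (corner1, 1) := by
    intro w β h
    rw [rel, Prod.mk.injEq] at h ⊢
    refine ⟨?_, ?_⟩
    · rw [h.1]; push_cast; ring
    · have h2 := h.2
      simp at h2 ⊢
      linarith
  rcases hv with rfl | rfl | rfl | rfl | rfl | rfl
  · exact ⟨0, 1, by simp, by simp [rel, corner1]⟩
  · exact ⟨0, -1, by simp, by simp [rel, corner1]⟩
  · exact ⟨_, _, .inr rfl, h2⟩
  · exact ⟨_, _, .inl rfl, neg h2⟩
  · exact ⟨_, _, .inr rfl, h3⟩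
  · exact ⟨_, _, .inl rfl, neg h3⟩

theorem herm_corner {v : ℂ} (hv : v ∈ sixPoints) {c : O11} (hc : c ≠ 0) (d : O11) :
    1 ≤ herm c d (v, 1) := by
  obtain ⟨β, δ, hδ, h⟩ := exists_rel_corner1 hv
  rw [h, herm_rel _ _ _ hδ]
  exact_mod_cast herm_corner1 hc (δ * (d + c * β))

theorem neg_mem_sixPoints {v : ℂ} (hv : v ∈ sixPoints) : -v ∈ sixPoints := by
  rcases hv with rfl | rfl | rfl | rfl | rfl | rfl <;> simp [sixPoints]

theorem corner1_mem : corner1 ∈ sixPoints := by simp [sixPoints, corner1]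
theorem corner2_mem : corner2 ∈ sixPoints := by simp [sixPoints, corner2]
theorem corner3_mem : corner3 ∈ sixPoints := by simp [sixPoints, corner3]

theorem sign_mul_mem_sixPoints {v : ℂ} (hv : v ∈ sixPoints) {ε : ℤ} (hε : ε = 1 ∨ ε = -1) :
    ε * v ∈ sixPoints := by
  rcases hε with rfl | rfl
  · simpa using hv
  · simpa using neg_mem_sixPoints hv

theorem normSq_corner {v : ℂ} (hv : v ∈ sixPoints) : Complex.normSq v + 2 / 11 = 1 := by
  have h1 : Complex.normSq corner1 + 2 / 11 = 1 := by
    rw [corner1_eq, Complex.normSq_mk]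
    linear_combination (9 / 121) * sqrt_sq
  have h2 : Complex.normSq corner2 + 2 / 11 = 1 := by
    rw [corner2_coord, Complex.normSq_mk]
    linear_combination (25 / 484) * sqrt_sq
  have h3 : Complex.normSq corner3 + 2 / 11 = 1 := by
    rw [corner3_coord, Complex.normSq_mk]
    linear_combination (25 / 484) * sqrt_sq
  rcases hv with rfl | rfl | rfl | rfl | rfl | rfl <;>
    simpa only [Complex.normSq_neg]

/-! ## The triangulation of the hexagons -/

/-- The three types of triangles `0, v, v'` that, together with their negatives, make up the
hexagon. Over such a triangle around a multiple of `π`, the region is bounded by the sphere of a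
row `(π κ, d)`. -/
def IsTriangle (κ : O11) (v v' : ℂ) : Prop :=
  κ = omO + 1 ∧ v = corner1 ∧ v' = corner2 ∨ κ = 1 ∧ v = corner2 ∧ v' = -corner3 ∨
    κ = omO ∧ v = corner1 ∧ v' = corner3

theorem IsTriangle.mem {κ : O11} {v v' : ℂ} (h : IsTriangle κ v v') :
    v ∈ sixPoints ∧ v' ∈ sixPoints := by
  rcases h with ⟨-, rfl, rfl⟩ | ⟨-, rfl, rfl⟩ | ⟨-, rfl, rfl⟩
  · exact ⟨corner1_mem, corner2_mem⟩
  · exact ⟨corner2_mem, neg_mem_sixPoints corner3_mem⟩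
  · exact ⟨corner1_mem, corner3_mem⟩

theorem omO_ne_zero : omO ≠ 0 := fun h => om_ne_zero (congrArg Subtype.val h)

theorem omO_add_one_ne_zero : omO + 1 ≠ 0 := fun h => om_add_one_ne_zero (congrArg Subtype.val h)

theorem IsTriangle.ne_zero {κ : O11} {v v' : ℂ} (h : IsTriangle κ v v') : κ ≠ 0 := by
  rcases h with ⟨rfl, -, -⟩ | ⟨rfl, -, -⟩ | ⟨rfl, -, -⟩
  · exact omO_add_one_ne_zero
  · exact one_ne_zero
  · exact omO_ne_zero

/-- This says that the plane of the row `(κ, 1)`, which contains `(0, 0)`, also contains `(v, 1)`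
and `(v', 1)`. -/
theorem IsTriangle.re_mul {κ : O11} {v v' : ℂ} (h : IsTriangle κ v v') :
    2 * ((κ : ℂ) * v).re = -Complex.normSq (κ : ℂ) ∧
      2 * ((κ : ℂ) * v').re = -Complex.normSq (κ : ℂ) := by
  have hs := sqrt_sq
  rcases h with ⟨rfl, rfl, rfl⟩ | ⟨rfl, rfl, rfl⟩ | ⟨rfl, rfl, rfl⟩
  · push_cast
    rw [coe_omO, normSq_om_add_one, corner1_eq, corner2_coord]
    simp [om_re, om_im]
    constructor <;> nlinarith
  · rw [corner2_coord, corner3_coord]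
    norm_num
  · rw [coe_omO, normSq_om, corner1_eq, corner3_coord]
    simp [om_re, om_im]
    constructor <;> nlinarith

open Classical in
/-- The squared scaled height of the apex over `α`: the top of a unit sphere, or a cusp. -/
def apex (π α : O11) : ℝ := if π ∣ α then 0 else 1

open Classical in
/-- The row whose sphere bounds the region over a triangle in the hexagon around `α`. -/
def faceRow (π α κ : O11) (ε : ℤ) : O11 × O11 :=
  if π ∣ α then (κ, -κ * α + ε) else (1, -α)

theorem isCoprime_face {π κ α : O11} (h : π ∣ α) {ε : ℤ} (hε : ε = 1 ∨ ε = -1) :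
    IsCoprime (π * κ) (-κ * α + ε) := by
  obtain ⟨β, rfl⟩ := h
  refine ⟨ε * β, ε, ?_⟩
  rcases hε with rfl | rfl <;> push_cast <;> ring

theorem isCoprime_unit {π α : O11} (hπ : Prime π) (h : ¬ π ∣ α) :
    IsCoprime (π * 1) (-α) := by
  rw [mul_one, IsCoprime.neg_right_iff]
  exact (hπ.irreducible.coprime_iff_not_dvd).mpr h

theorem faceRow_valid {π α κ : O11} {v v' : ℂ} (hπ : Prime π) (h : IsTriangle κ v v')
    {ε : ℤ} (hε : ε = 1 ∨ ε = -1) :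
    (faceRow π α κ ε).1 ≠ 0 ∧ IsCoprime (π * (faceRow π α κ ε).1) (faceRow π α κ ε).2 := by
  unfold faceRow
  split_ifs with hα
  · exact ⟨h.ne_zero, isCoprime_face hα hε⟩
  · exact ⟨one_ne_zero, isCoprime_unit hπ hα⟩

/-- The affine function of `faceRow` is `1` at the two corners and at the apex. Elsewhere it grows
with slope `|c|²` in the vertical distance from their plane. -/
theorem herm_faceRow {π α κ : O11} {v v' : ℂ} (h : IsTriangle κ v v')
    {ε : ℤ} (hε : ε = 1 ∨ ε = -1) (a b w : ℝ) :
    herm (faceRow π α κ ε).1 (faceRow π α κ ε).2 (rel α ε (a * v + b * v', w)) =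
      1 + Complex.normSq (faceRow π α κ ε).1 * (w - (a + b + (1 - a - b) * apex π α)) := by
  unfold faceRow apex
  split_ifs with hα
  · have h1 : ((-κ * α + ε : O11) : ℂ) = -(κ : ℂ) * α + ε * 1 := by push_cast; ring
    dsimp only
    rw [h1, herm_rel' _ _ _ hε, herm]
    have h2 : ((κ : ℂ) * (a * v + b * v') * conj 1).re = a * (κ * v).re + b * (κ * v').re := by
      rw [map_one, mul_one, ← Complex.re_ofReal_mul, ← Complex.re_ofReal_mul, ← Complex.add_re]
      congr 1
      ring
    rw [h2, map_one]
    linear_combination a * h.re_mul.1 + b * h.re_mul.2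
  · have h1 : ((-α : O11) : ℂ) = -((1 : O11) : ℂ) * α + ε * 0 := by push_cast; ring
    dsimp only
    rw [h1, herm_rel' _ _ _ hε, herm]
    simp

theorem apex_mem {π α : O11} (hπ : Prime π) (ε : ℤ) : rel α ε (0, apex π α) ∈ aboveAll π := by
  unfold apex rel
  split_ifs with hα
  · simpa using cusp_mem_aboveAll hπ hα
  · simpa using high_mem_aboveAll π le_rfl

theorem corner_mem {π α : O11} {v : ℂ} (hv : v ∈ sixPoints) {ε : ℤ} (hε : ε = 1 ∨ ε = -1) :
    rel α ε (v, 1) ∈ aboveAll π := by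
  intro c d hc _
  rw [herm_rel _ _ _ hε]
  exact_mod_cast herm_corner hv hc (ε * (d + c * α))

theorem rel_combo (α : ℂ) (ε : ℤ) (v v' : ℂ) (a b s t t' : ℝ) :
    rel α ε (a * v + b * v', a * t + b * t' + (1 - a - b) * s) =
      a • rel α ε (v, t) + b • rel α ε (v', t') + (1 - a - b) • rel α ε (0, s) := by
  apply Prod.ext
  · simp [rel]; ring
  · simp [rel]; ring

theorem herm_combo₃ (c d : ℂ) (P Q R : ℂ × ℝ) (a b : ℝ) :
    herm c d (a • P + b • Q + (1 - a - b) • R) =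
      a * herm c d P + b * herm c d Q + (1 - a - b) * herm c d R := by
  simp [herm]
  ring

/-- The plane of `faceRow` bounds the set from below. Points on that plane over the triangle are
convex combinations of two corners and the apex, where all inequalities hold. -/
theorem tile_mem {π α κ : O11} {v v' : ℂ} (hπ : Prime π) (h : IsTriangle κ v v')
    {ε : ℤ} (hε : ε = 1 ∨ ε = -1) {a b : ℝ} (ha : 0 ≤ a) (hb : 0 ≤ b) (hab : a + b ≤ 1) (w : ℝ) :
    rel α ε (a * v + b * v', w) ∈ aboveAll π ↔ a + b + (1 - a - b) * apex π α ≤ w := by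
  constructor
  · intro hP
    obtain ⟨h1, h2⟩ := faceRow_valid (α := α) hπ h hε
    have h3 := hP _ _ h1 h2
    rw [herm_faceRow h hε] at h3
    have h4 := one_le_normSq h1
    nlinarith
  · intro hw
    refine aboveAll_mono (w := (rel α ε (a * v + b * v', a + b + (1 - a - b) * apex π α)).2) ?_ ?_
    · simp only [rel]
      linarith
    · have := rel_combo α ε v v' a b (apex π α) 1 1
      rw [mul_one, mul_one] at this
      intro c d hc hcd
      change 1 ≤ herm c d (rel α ε (a * v + b * v', a + b + (1 - a - b) * apex π α))
      rw [this, herm_combo₃]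
      have h1 := corner_mem (π := π) (α := α) h.mem.1 hε c d hc hcd
      have h2 := corner_mem (π := π) (α := α) h.mem.2 hε c d hc hcd
      have h3 := apex_mem (α := α) hπ ε c d hc hcd
      nlinarith

theorem Hex.exists_triangle {u : ℂ} (hu : Hex u) :
    ∃ (ε : ℤ) (κ : O11) (v v' : ℂ) (a b : ℝ), (ε = 1 ∨ ε = -1) ∧ IsTriangle κ v v' ∧
      0 ≤ a ∧ 0 ≤ b ∧ a + b ≤ 1 ∧ u = ε * (a * v + b * v') := by
  obtain ⟨h1, h2, h3⟩ := hu
  rw [abs_le] at h1 h2 h3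
  obtain ⟨X, y⟩ := u
  dsimp only at *
  have hy : y = √11 * y * √11 / 11 := by linear_combination (-y / 11) * sqrt_sq
  generalize √11 * y = Y at *
  subst hy
  -- In the coordinates `(X, Y)` with `Y = √11 y` the corners are `±(0, 3)`, `±(-1/2, 5/2)`, `±(1/2,
  -- 5/2)`. The lines `|Y| = 5|X|` and `X = 0` cut out the six triangles, and the weights solve a
  -- linear system in each.
  have main : ∀ ε : ℤ, (ε = 1 ∨ ε = -1) → 5 * |X| ≤ ε * Y →
    ∃ (ε : ℤ) (κ : O11) (v v' : ℂ) (a b : ℝ), (ε = 1 ∨ ε = -1) ∧ IsTriangle κ v v' ∧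
      0 ≤ a ∧ 0 ≤ b ∧ a + b ≤ 1 ∧ (⟨X, Y * √11 / 11⟩ : ℂ) = ε * (a * v + b * v') := by
    intro ε hε hY
    have h5 := le_abs_self X
    have h6 := neg_abs_le X
    rcases le_total (ε * X) 0 with hX | hX
    · refine ⟨ε, omO + 1, corner1, corner2, (ε * Y + 5 * (ε * X)) / 3, -2 * (ε * X), hε,
        .inl ⟨rfl, rfl, rfl⟩, ?_, ?_, ?_, ?_⟩
      · rcases hε with rfl | rfl <;> push_cast at * <;> linarith
      · linarith
      · rcases hε with rfl | rfl <;> push_cast at * <;> linarith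
      · rw [corner1_eq, corner2_coord]
        rcases hε with rfl | rfl <;> (apply Complex.ext <;> simp <;> ring)
    · refine ⟨ε, omO, corner1, corner3, (ε * Y - 5 * (ε * X)) / 3, 2 * (ε * X), hε,
        .inr (.inr ⟨rfl, rfl, rfl⟩), ?_, ?_, ?_, ?_⟩
      · rcases hε with rfl | rfl <;> push_cast at * <;> linarith
      · linarith
      · rcases hε with rfl | rfl <;> push_cast at * <;> linarith
      · rw [corner1_eq, corner3_coord]
        rcases hε with rfl | rfl <;> (apply Complex.ext <;> simp <;> ring)
  have main' : ∀ ε : ℤ, (ε = 1 ∨ ε = -1) → |Y| ≤ -(5 * (ε * X)) →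
    ∃ (ε : ℤ) (κ : O11) (v v' : ℂ) (a b : ℝ), (ε = 1 ∨ ε = -1) ∧ IsTriangle κ v v' ∧
      0 ≤ a ∧ 0 ≤ b ∧ a + b ≤ 1 ∧ (⟨X, Y * √11 / 11⟩ : ℂ) = ε * (a * v + b * v') := by
    intro ε hε hY
    rw [abs_le] at hY
    refine ⟨ε, 1, corner2, -corner3, -(ε * X) + ε * Y / 5, -(ε * X) - ε * Y / 5, hε,
      .inr (.inl ⟨rfl, rfl, rfl⟩), ?_, ?_, ?_, ?_⟩
    · rcases hε with rfl | rfl <;> push_cast at * <;> linarith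
    · rcases hε with rfl | rfl <;> push_cast at * <;> linarith
    · rcases hε with rfl | rfl <;> push_cast at * <;> linarith
    · rw [corner2_coord, corner3_coord]
      rcases hε with rfl | rfl <;> (apply Complex.ext <;> simp <;> ring)
  rcases le_total (5 * |X|) |Y| with h | h
  · rcases abs_cases Y with ⟨hY, _⟩ | ⟨hY, _⟩
    · exact main 1 (.inl rfl) (by push_cast; linarith)
    · exact main (-1) (.inr rfl) (by push_cast; linarith)
  · rcases abs_cases X with ⟨hX, _⟩ | ⟨hX, _⟩
    · exact main' (-1) (.inr rfl) (by push_cast; linarith)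
    · exact main' 1 (.inl rfl) (by push_cast; linarith)

theorem convex_hex : Convex ℝ {u | Hex u} := by
  intro u hu v hv a b ha hb hab
  obtain ⟨h1, h2, h3⟩ := hu
  obtain ⟨k1, k2, k3⟩ := hv
  obtain rfl : b = 1 - a := by linarith
  rw [abs_le] at h1 h2 h3 k1 k2 k3
  simp only [Set.mem_ofPred_eq, Hex, abs_le]
  simp
  refine ⟨⟨?_, ?_⟩, ⟨?_, ?_⟩, ?_, ?_⟩ <;> nlinarith

theorem hex_of_mem {v : ℂ} (hv : v ∈ sixPoints) : Hex v := by
  have hs := sqrt_sq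
  have neg : ∀ {u}, Hex u → Hex (-u) := by
    intro u ⟨h1, h2, h3⟩
    simp only [abs_le, Hex, Complex.neg_re, Complex.neg_im] at *
    refine ⟨⟨?_, ?_⟩, ⟨?_, ?_⟩, ?_, ?_⟩ <;> linarith
  have h1 : Hex corner1 := by
    rw [corner1_eq, Hex]
    simp only [abs_le]
    refine ⟨⟨?_, ?_⟩, ⟨?_, ?_⟩, ?_, ?_⟩ <;> nlinarith
  have h2 : Hex corner2 := by
    rw [corner2_coord, Hex]
    simp only [abs_le]
    refine ⟨⟨?_, ?_⟩, ⟨?_, ?_⟩, ?_, ?_⟩ <;> nlinarith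
  have h3 : Hex corner3 := by
    rw [corner3_coord, Hex]
    simp only [abs_le]
    refine ⟨⟨?_, ?_⟩, ⟨?_, ?_⟩, ?_, ?_⟩ <;> nlinarith
  rcases hv with rfl | rfl | rfl | rfl | rfl | rfl
  exacts [h1, neg h1, h2, neg h2, h3, neg h3]

theorem convexHull_sixPoints : convexHull ℝ sixPoints = {u | Hex u} := by
  apply Set.Subset.antisymm
  · exact convexHull_min (fun v hv => hex_of_mem hv) convex_hex
  · intro u hu
    obtain ⟨ε, κ, v, v', a, b, hε, h, ha, hb, hab, rfl⟩ := hu.exists_triangle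
    have hc := convex_convexHull ℝ sixPoints
    have h0 : (0 : ℂ) ∈ convexHull ℝ sixPoints := by
      have := hc (subset_convexHull ℝ _ corner1_mem)
        (subset_convexHull ℝ _ (neg_mem_sixPoints corner1_mem))
        (by norm_num : (0 : ℝ) ≤ 1 / 2) (by norm_num : (0 : ℝ) ≤ 1 / 2) (by norm_num)
      simpa using this
    have := hc.sum_mem (t := Finset.univ) (w := ![a, b, 1 - a - b]) (z := ![ε * v, ε * v', 0])
      (by intro i _; fin_cases i <;> simp [*] ; linarith)
      (by simp [Fin.sum_univ_three])
      (by
        intro i _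
        fin_cases i
        · exact subset_convexHull ℝ _ (sign_mul_mem_sixPoints h.mem.1 hε)
        · exact subset_convexHull ℝ _ (sign_mul_mem_sixPoints h.mem.2 hε)
        · exact h0)
    simp [Fin.sum_univ_three] at this
    convert this using 1
    ring

/-- All half-planes of the Voronoi cell follow from the six in `Hex`. The inequality is linear in
`u`, so it need only be checked at the corners, where it is `herm_corner` for the row `(1, -l)`. -/
theorem Hex.two_mul_re_le {u : ℂ} (hu : Hex u) (l : O11) :
    2 * (u * conj (l : ℂ)).re ≤ Complex.normSq (l : ℂ) := by
  have hu' : u ∈ convexHull ℝ sixPoints := convexHull_sixPoints ▸ hu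
  have hconv : Convex ℝ {u : ℂ | 2 * (u * conj (l : ℂ)).re ≤ Complex.normSq (l : ℂ)} := by
    intro u hu v hv a b ha hb hab
    obtain rfl : b = 1 - a := by linarith
    simp only [Set.mem_ofPred_eq] at *
    have : ((a • u + (1 - a) • v) * conj (l : ℂ)).re =
      a * (u * conj (l : ℂ)).re + (1 - a) * (v * conj (l : ℂ)).re := by
      simp
      ring
    rw [this]
    nlinarith
  refine convexHull_min ?_ hconv hu'
  intro v hv
  have := herm_corner hv (one_ne_zero : (1 : O11) ≠ 0) (-l)
  simp [herm] at this
  simp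
  linarith

theorem exists_tile {P : ℂ × ℝ} {α : O11} (h : Hex (P.1 - α)) :
    ∃ (ε : ℤ) (κ : O11) (v v' : ℂ) (a b w : ℝ), (ε = 1 ∨ ε = -1) ∧ IsTriangle κ v v' ∧
      0 ≤ a ∧ 0 ≤ b ∧ a + b ≤ 1 ∧ P = rel α ε (a * v + b * v', w) := by
  obtain ⟨ε, κ, v, v', a, b, hε, h, ha, hb, hab, h'⟩ := h.exists_triangle
  refine ⟨ε, κ, v, v', a, b, P.2 - (Complex.normSq (α : ℂ) +
    2 * ε * ((a * v + b * v') * conj (α : ℂ)).re), hε, h, ha, hb, hab, ?_⟩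
  apply Prod.ext
  · simp only [rel]
    rw [← h']
    ring
  · simp only [rel]
    ring

/-! ## Representatives of the residue classes modulo `π` -/

theorem int_dvd_of_dvd {p : ℕ} (hp : p.Prime) {π : O11} (hπ : Prime π) (hdvd : π ∣ (p : O11))
    {n : ℤ} (h : π ∣ (n : O11)) : (p : ℤ) ∣ n := by
  by_contra hn
  obtain ⟨x, y, hxy⟩ := (Nat.prime_iff_prime_int.mp hp).irreducible.coprime_iff_not_dvd.mpr hn
  apply hπ.not_isUnit
  apply isUnit_of_dvd_one
  have : (1 : O11) = x * p + y * n := by exact_mod_cast congrArg (Int.cast : ℤ → O11) hxy.symm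
  rw [this]
  exact dvd_add (hdvd.mul_left _) (h.mul_left _)

theorem dvd_coord {p : ℕ} {a b : ℤ} (h : (p : O11) ∣ a + b * omO) : (p : ℤ) ∣ a ∧ (p : ℤ) ∣ b := by
  obtain ⟨x, hx⟩ := h
  obtain ⟨c, d, rfl⟩ := exists_coord x
  have := congrArg (Subtype.val) hx
  push_cast at this
  have := @coord_inj a b (p * c) (p * d) (by rw [coe_omO] at this; push_cast; rw [this]; ring)
  exact ⟨⟨c, this.1⟩, ⟨d, this.2⟩⟩

theorem associated_of_prime {p : ℕ} {π : O11} (hπ : Prime π) (hdvd : π ∣ (p : O11))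
    (hp : Prime (p : O11)) : (p : O11) ∣ π :=
  ((hp.irreducible.dvd_iff.mp hdvd).resolve_left hπ.not_isUnit).dvd

/-- If `p` is not inert then `N(π) = p` and the residue field is the prime field. It is enough to
find an integer congruent to `ω`. -/
theorem exists_int_congr {p : ℕ} (hp : p.Prime) {π : O11} (hπ : Prime π)
    (hdvd : π ∣ (p : O11)) (hnp : ¬ Prime (p : O11)) (α : O11) :
    ∃ n : ℤ, π ∣ α - n := by
  have hpi := Nat.prime_iff_prime_int.mp hp
  suffices h : ∃ n : ℤ, π ∣ omO - n by
    obtain ⟨n, hn⟩ := h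
    obtain ⟨a, b, rfl⟩ := exists_coord α
    refine ⟨a + b * n, ?_⟩
    convert hn.mul_left (b : O11) using 1
    push_cast
    ring
  obtain ⟨σ, hσ⟩ := hdvd
  obtain ⟨a, b, hab⟩ := exists_coord π
  obtain ⟨c, d, hcd⟩ := exists_coord σ
  have hNπ : Complex.normSq (π : ℂ) = ((a ^ 2 - a * b + 3 * b ^ 2 : ℤ) : ℝ) := by
    rw [hab]; exact normSq_coord a b
  have hNσ : Complex.normSq (σ : ℂ) = ((c ^ 2 - c * d + 3 * d ^ 2 : ℤ) : ℝ) := by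
    rw [hcd]; exact normSq_coord c d
  have hprod : (a ^ 2 - a * b + 3 * b ^ 2) * (c ^ 2 - c * d + 3 * d ^ 2) = (p : ℤ) ^ 2 := by
    have h1 := congrArg (fun x : O11 => Complex.normSq (x : ℂ)) hσ
    simp only [MulMemClass.coe_mul, map_mul, hNπ, hNσ] at h1
    have h2 : Complex.normSq ((p : O11) : ℂ) = (p : ℝ) ^ 2 := by
      simp [sq]
    rw [h2] at h1
    exact_mod_cast h1.symm
  have hN1 : a ^ 2 - a * b + 3 * b ^ 2 ≠ 1 := fun h =>
    hπ.not_isUnit (isUnit_of_normSq_eq_one (by rw [hNπ, h]; simp))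
  have hN2 : c ^ 2 - c * d + 3 * d ^ 2 ≠ 1 := by
    intro h
    have hu : IsUnit σ := isUnit_of_normSq_eq_one (by rw [hNσ, h]; simp)
    apply hnp
    rw [hσ]
    exact (associated_mul_unit_right π σ hu).prime hπ
  have hN0 : 0 ≤ a ^ 2 - a * b + 3 * b ^ 2 := by nlinarith [sq_nonneg (2 * a - b)]
  have hN0' : 0 ≤ c ^ 2 - c * d + 3 * d ^ 2 := by nlinarith [sq_nonneg (2 * c - d)]
  -- The norms of `π` and its cofactor multiply to `p²` and neither is `1`.
  have hNp : a ^ 2 - a * b + 3 * b ^ 2 = p := by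
    lift a ^ 2 - a * b + 3 * b ^ 2 to ℕ using hN0 with m
    lift c ^ 2 - c * d + 3 * d ^ 2 to ℕ using hN0' with n
    norm_cast at *
    exact ((Nat.Prime.mul_eq_prime_sq_iff hp hN1 hN2).mp hprod).1
  have hb : ¬ (p : ℤ) ∣ b := by
    intro hb
    have ha : (p : ℤ) ∣ a := by
      apply hpi.dvd_of_dvd_pow (n := 2)
      have : a ^ 2 = p + b * (a - 3 * b) := by linear_combination hNp
      rw [this]
      exact dvd_add dvd_rfl (hb.mul_right _)
    obtain ⟨a', rfl⟩ := ha
    obtain ⟨b', rfl⟩ := hb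
    have h1 : (p : ℤ) * ((a' ^ 2 - a' * b' + 3 * b' ^ 2) * p) = p * 1 := by
      linear_combination hNp
    have h2 := mul_left_cancel₀ hpi.ne_zero h1
    exact hpi.not_isUnit (.of_mul_eq_one_right _ h2)
  obtain ⟨x, y, hxy⟩ := hpi.irreducible.coprime_iff_not_dvd.mpr hb
  -- From `xp + yb = 1` and `π = a + bω` it follows that `ω ≡ ybω ≡ -ya` modulo `π`.
  refine ⟨-a * y, ?_⟩
  have : omO - ((-a * y : ℤ) : O11) = y * π + x * omO * p := by
    have h1 : (x * p + y * b : O11) = 1 := by exact_mod_cast congrArg (Int.cast : ℤ → O11) hxy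
    rw [hab]
    push_cast
    linear_combination -omO * h1
  rw [this, hσ]
  exact dvd_add (dvd_mul_left _ _) ((dvd_mul_right _ _).mul_left _)

theorem exists_balanced {p : ℕ} (hp : p.Prime) (hodd : p ≠ 2) (n : ℤ) :
    ∃ j : ℤ, 2 * |j| ≤ (p : ℤ) - 1 ∧ (p : ℤ) ∣ n - j := by
  obtain ⟨m, hm⟩ := hp.odd_of_ne_two hodd
  have hp0 : (0 : ℤ) < p := by exact_mod_cast hp.pos
  have h1 := Int.emod_nonneg (n + m) hp0.ne'
  have h2 := Int.emod_lt_of_pos (n + m) hp0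
  have h3 := Int.emod_add_mul_ediv (n + m) p
  refine ⟨(n + m) % p - m, ?_, ⟨(n + m) / p, by linarith⟩⟩
  have : |(n + m) % p - m| ≤ m := abs_le.mpr ⟨by linarith, by omega⟩
  omega

theorem balanced_inj {p : ℕ} {j j' : ℤ} (hj : 2 * |j| ≤ (p : ℤ) - 1) (hj' : 2 * |j'| ≤ (p : ℤ) - 1)
    (h : (p : ℤ) ∣ j - j') : j = j' := by
  have h1 := abs_sub j j'
  rw [← sub_eq_zero]
  exact Int.eq_zero_of_abs_lt_dvd h (by linarith)

theorem exists_coe_of_mem_representatives {p : ℕ} {ρ : ℂ} (h : ρ ∈ representatives p) :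
    ∃ r : O11, ρ = r := by
  rcases h with ⟨-, j, -, rfl⟩ | ⟨-, j, k, -, -, rfl⟩
  · exact ⟨j, rfl⟩
  · exact ⟨j + k * omO, rfl⟩

theorem exists_representative {p : ℕ} (hp : p.Prime) (hodd : p ≠ 2) {π : O11} (hπ : Prime π)
    (hdvd : π ∣ (p : O11)) (α : O11) :
    ∃ r : O11, (r : ℂ) ∈ representatives p ∧ π ∣ α - r := by
  have key : ∀ n : ℤ, (p : ℤ) ∣ n → π ∣ (n : O11) := by
    rintro n ⟨m, rfl⟩
    push_cast
    exact hdvd.mul_right _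
  by_cases hpp : Prime (p : O11)
  · obtain ⟨a, b, rfl⟩ := exists_coord α
    obtain ⟨j, hj, hj'⟩ := exists_balanced hp hodd a
    obtain ⟨k, hk, hk'⟩ := exists_balanced hp hodd b
    refine ⟨j + k * omO, .inr ⟨hpp, j, k, hj, hk, rfl⟩, ?_⟩
    convert dvd_add (key _ hj') ((key _ hk').mul_right omO) using 1
    push_cast
    ring
  · obtain ⟨n, hn⟩ := exists_int_congr hp hπ hdvd hpp α
    obtain ⟨j, hj, hj'⟩ := exists_balanced hp hodd n
    refine ⟨j, .inl ⟨hpp, j, hj, rfl⟩, ?_⟩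
    convert dvd_add hn (key _ hj') using 1
    push_cast
    ring

theorem representatives_inj {p : ℕ} (hp : p.Prime) {π : O11} (hπ : Prime π)
    (hdvd : π ∣ (p : O11)) {r r' : O11} (hr : (r : ℂ) ∈ representatives p)
    (hr' : (r' : ℂ) ∈ representatives p) (h : π ∣ r - r') : r = r' := by
  rcases hr with ⟨h1, j, hj, hr⟩ | ⟨h1, j, k, hj, hk, hr⟩ <;>
    rcases hr' with ⟨h2, j', hj', hr'⟩ | ⟨h2, j', k', hj', hk', hr'⟩
  · obtain rfl : r = j := Subtype.ext hr
    obtain rfl : r' = j' := Subtype.ext hr'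
    rw [balanced_inj hj hj' (int_dvd_of_dvd hp hπ hdvd (by exact_mod_cast h))]
  · exact absurd h2 h1
  · exact absurd h1 h2
  · obtain rfl : r = j + k * omO := Subtype.ext hr
    obtain rfl : r' = j' + k' * omO := Subtype.ext hr'
    have h3 := (associated_of_prime hπ hdvd h1).trans h
    obtain ⟨h4, h5⟩ := dvd_coord (a := j - j') (b := k - k')
      (by convert h3 using 1; push_cast; ring)
    rw [balanced_inj hj hj' h4, balanced_inj hk hk' h5]

theorem int_mem_representatives {p : ℕ} {j : ℤ} (hj : 2 * |j| ≤ (p : ℤ) - 1) :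
    (j : ℂ) ∈ representatives p := by
  by_cases hpp : Prime (p : O11)
  · exact .inr ⟨hpp, j, 0, hj, by have := abs_nonneg j; simp; linarith, by simp⟩
  · exact .inl ⟨hpp, j, hj, rfl⟩

theorem zero_mem_representatives {p : ℕ} (hp : p.Prime) : (0 : ℂ) ∈ representatives p := by
  have := hp.pos
  exact_mod_cast int_mem_representatives (p := p) (j := 0) (by simp; omega)

theorem sign_mem_representatives {p : ℕ} (hp : p.Prime) (hodd : p ≠ 2) {ε : ℤ}
    (hε : ε = 1 ∨ ε = -1) : (ε : ℂ) ∈ representatives p := by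
  have := hp.two_le
  apply int_mem_representatives
  rcases hε with rfl | rfl <;> simp <;> omega

theorem finite_representatives (p : ℕ) : (representatives p).Finite := by
  refine ((Set.finite_Icc (-(p : ℤ)) p).prod (Set.finite_Icc (-(p : ℤ)) p)
    |>.image (fun q : ℤ × ℤ => (q.1 + q.2 * om : ℂ))).subset ?_
  rintro ρ (⟨-, j, hj, rfl⟩ | ⟨-, j, k, hj, hk, rfl⟩)
  · have := abs_nonneg j
    exact ⟨(j, 0), ⟨abs_le.mp (by linarith), by simp⟩, by simp⟩
  · have := abs_nonneg j
    have := abs_nonneg k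
    exact ⟨(j, k), ⟨abs_le.mp (by linarith), abs_le.mp (by linarith)⟩, rfl⟩

theorem dvd_representative {p : ℕ} (hp : p.Prime) {π : O11} (hπ : Prime π)
    (hdvd : π ∣ (p : O11)) {r : O11} (hr : (r : ℂ) ∈ representatives p) : π ∣ r ↔ r = 0 := by
  constructor
  · intro h
    exact representatives_inj hp hπ hdvd hr (by simpa using zero_mem_representatives hp)
      (by simpa using h)
  · rintro rfl
    exact dvd_zero π

/-! ## The spheres over the triangles -/

theorem coe_ne_zero {x : O11} (h : x ≠ 0) : (x : ℂ) ≠ 0 := by simpa using h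

theorem nrm_pos {π : O11} (hπ : π ≠ 0) : 0 < nrm π := by
  rw [nrm_eq]
  exact Complex.normSq_pos.mpr (coe_ne_zero hπ)

theorem smallRadius_pos {π : O11} (hπ : π ≠ 0) : 0 < smallRadius π := by
  have := nrm_pos hπ
  unfold smallRadius
  positivity

theorem smallRadius_eq {π κ : O11} (hκ : κ = omO ∨ κ = omO + 1) :
    1 / ‖(π * κ : ℂ)‖ = smallRadius π := by
  have h : ‖(κ : ℂ)‖ ^ 2 = 3 := by
    rw [← Complex.normSq_eq_norm_sq]
    rcases hκ with rfl | rfl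
    · exact normSq_om
    · exact normSq_om_add_one
  rw [smallRadius, nrm, ← h, ← mul_pow, Real.sqrt_sq (by positivity), norm_mul, mul_comm]

theorem mem_smallCenters {π : O11} {c : ℂ} :
    c ∈ smallCenters π ↔ ∃ (ε : ℤ) (κ : O11), (ε = 1 ∨ ε = -1) ∧ (κ = omO ∨ κ = omO + 1) ∧
      c = -ε / (κ * π) := by
  constructor
  · rintro (rfl | rfl | rfl | rfl)
    · exact ⟨-1, omO, by simp, by simp, by simp⟩
    · exact ⟨1, omO, by simp, by simp, by simp [neg_div]⟩
    · exact ⟨-1, omO + 1, by simp, by simp, by simp⟩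
    · exact ⟨1, omO + 1, by simp, by simp, by simp [neg_div]⟩
  · rintro ⟨ε, κ, rfl | rfl, rfl | rfl, rfl⟩ <;> simp [smallCenters, neg_div]

theorem exists_isTriangle {κ : O11} (hκ : κ = omO ∨ κ = omO + 1) : ∃ v v', IsTriangle κ v v' := by
  rcases hκ with rfl | rfl
  · exact ⟨_, _, .inr (.inr ⟨rfl, rfl, rfl⟩)⟩
  · exact ⟨_, _, .inl ⟨rfl, rfl, rfl⟩⟩

theorem IsTriangle.cases {κ : O11} {v v' : ℂ} (h : IsTriangle κ v v') :
    κ = 1 ∨ κ = omO ∨ κ = omO + 1 := by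
  rcases h with ⟨rfl, -⟩ | ⟨rfl, -⟩ | ⟨rfl, -⟩ <;> simp

/-- The row sphere over a triangle around a cusp. -/
theorem center_face {π κ : O11} (hπ : π ≠ 0) (hκ : κ ≠ 0) (β : O11) (ε : ℤ) :
    -((-κ * (π * β) + ε : O11) : ℂ) / (π * κ) = -ε / (κ * π) + β := by
  have h1 := coe_ne_zero hπ
  have h2 := coe_ne_zero hκ
  push_cast
  field_simp
  ring

/-- The spheres below the triangles are exactly of the two claimed types. Around a multiple of `π`,
the triangles with `κ = 1` lie under the large sphere of the neighbour `α - ε`. -/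
theorem face_cases {π α κ : O11} {v v' : ℂ} (hπ : Prime π) (h : IsTriangle κ v v')
    {ε : ℤ} (hε : ε = 1 ∨ ε = -1) :
    (∃ γ : O11, ¬ π ∣ γ ∧ (γ = α ∨ π ∣ α ∧ γ = α - ε) ∧
      -((faceRow π α κ ε).2 : ℂ) / (π * (faceRow π α κ ε).1) = γ / π ∧
      1 / ‖(π * (faceRow π α κ ε).1 : ℂ)‖ = 1 / ‖(π : ℂ)‖) ∨
    ∃ β : O11, ∃ c ∈ smallCenters π, α = π * β ∧
      -((faceRow π α κ ε).2 : ℂ) / (π * (faceRow π α κ ε).1) = c + β ∧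
      1 / ‖(π * (faceRow π α κ ε).1 : ℂ)‖ = smallRadius π := by
  unfold faceRow
  split_ifs with hα
  · rcases h.cases with rfl | hκ
    · refine .inl ⟨α - ε, ?_, .inr ⟨hα, rfl⟩, ?_, ?_⟩
      · intro h1
        have h2 : π ∣ (ε : O11) := by
          have := dvd_sub hα h1
          rwa [sub_sub_cancel] at this
        apply hπ.not_isUnit
        apply isUnit_of_dvd_unit h2
        rcases hε with rfl | rfl <;> simp
      · push_cast
        ring
      · simp
    · obtain ⟨β, rfl⟩ := hα
      exact .inr ⟨β, -ε / (κ * π), mem_smallCenters.mpr ⟨ε, κ, hε, hκ, rfl⟩, rfl,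
        center_face hπ.ne_zero h.ne_zero β ε, smallRadius_eq hκ⟩
  · exact .inl ⟨α, hα, .inl rfl, by simp, by simp⟩

theorem rowSphere_unit (π α : O11) :
    rowSphere π 1 (-α) = hemisphere ((α : ℂ) / π) (1 / ‖(π : ℂ)‖) := by
  simp [rowSphere]

theorem rowSphere_neg (π c d : O11) : rowSphere π (-c) (-d) = rowSphere π c d := by
  simp [rowSphere, div_neg, neg_div]

theorem unit_mem_isometricSpheres {π α : O11} (hπ : Prime π) (hα : ¬ π ∣ α) :
    hemisphere ((α : ℂ) / π) (1 / ‖(π : ℂ)‖) ∈ isometricSpheres π :=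
  (mem_isometricSpheres hπ.ne_zero).mpr
    ⟨1, -α, one_ne_zero, isCoprime_unit hπ hα, (rowSphere_unit π α).symm⟩

theorem rowSphere_small {π κ : O11} (hπ : π ≠ 0) (hκ : κ = omO ∨ κ = omO + 1) (β : O11) (ε : ℤ) :
    rowSphere π κ (-κ * (π * β) + ε) = hemisphere (-ε / (κ * π) + β) (smallRadius π) := by
  obtain ⟨v, v', h⟩ := exists_isTriangle hκ
  rw [rowSphere, center_face hπ h.ne_zero, smallRadius_eq hκ]

theorem exists_scaled {π : O11} (hπ : π ≠ 0) {u : ℂ} {s : ℝ} (hs : 0 < s) :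
    ∃ x : H3, scaled π x = (u, Complex.normSq u + s) := by
  have hN := nrm_pos hπ
  refine ⟨⟨(u / π, √(s / nrm π)), Real.sqrt_pos.mpr (by positivity)⟩, ?_⟩
  rw [scaled_eq]
  dsimp only
  rw [mul_div_cancel₀ u (coe_ne_zero hπ), Real.sq_sqrt (by positivity), mul_div_cancel₀ s hN.ne']

theorem mem_column {π : O11} (hπ : π ≠ 0) {ρ : ℂ} {x : H3} :
    x ∈ column π ρ ↔ Hex ((scaled π x).1 - ρ) := by
  have h0 := coe_ne_zero hπ
  let f : ℂ →ᵃ[ℝ] ℂ :=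
    { toFun := fun z => (z + ρ) / π
      linear := LinearMap.mulRight ℝ ((π : ℂ)⁻¹)
      map_vadd' := fun z w => by simp; ring }
  have h1 : cellCorners π ρ = f '' sixPoints := rfl
  rw [column, Set.mem_ofPred_eq, h1, ← AffineMap.image_convexHull, convexHull_sixPoints]
  constructor
  · rintro ⟨u, hu, hux⟩
    have : (u + ρ) / π = x.1.1 := hux
    rw [scaled, ← this, mul_div_cancel₀ _ h0, add_sub_cancel_right]
    exact hu
  · intro h
    refine ⟨_, h, ?_⟩
    change (π * x.1.1 - ρ + ρ) / (π : ℂ) = x.1.1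
    field_simp
    ring

/-- Over each triangle, the region is bounded by the sphere of `faceRow`. -/
theorem herm_face_eq_one {π α κ : O11} {v v' : ℂ} (hπ : Prime π) (h : IsTriangle κ v v')
    {ε : ℤ} (hε : ε = 1 ∨ ε = -1) {a b w : ℝ} (ha : 0 ≤ a) (hb : 0 ≤ b) (hab : a + b ≤ 1)
    (hP : rel α ε (a * v + b * v', w) ∈ aboveAll π) {c d : O11} (hc : c ≠ 0)
    (hcd : IsCoprime (π * c) d) (h1 : herm c d (rel α ε (a * v + b * v', w)) = 1) :
    herm (faceRow π α κ ε).1 (faceRow π α κ ε).2 (rel α ε (a * v + b * v', w)) = 1 := by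
  set w₀ := a + b + (1 - a - b) * apex π α with hw₀
  have hw := (tile_mem hπ h hε ha hb hab w).mp hP
  have h2 := (tile_mem hπ h hε ha hb hab w₀).mpr hw₀.ge c d hc hcd
  have h3 : herm c d (rel α ε (a * v + b * v', w)) =
      herm c d (rel α ε (a * v + b * v', w₀)) + Complex.normSq (c : ℂ) * (w - w₀) := by
    simp only [herm, rel]
    ring
  have h4 := one_le_normSq hc
  rw [herm_faceRow h hε, ← hw₀]
  -- `herm c d` has slope at least `1` in `w` and is already at least `1` at `w₀`, so the value `1`
  -- at `w ≥ w₀` forces equality.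
  have : w = w₀ := by nlinarith
  rw [this]
  ring

/-- A point of the region on any isometric sphere lies on the tent, hence also on the sphere of
`faceRow`. Uniqueness identifies the two. -/
theorem face_of_mem_column {π : O11} (hπ : Prime π) {α : O11} {x : H3} (hx : x ∈ column π α)
    (hB : x ∈ exteriorRegion π) {S : Set H3} (hS : S ∈ isometricSpheres π) (hxS : x ∈ S)
    (huniq : ∀ S' ∈ isometricSpheres π, x ∈ S' → S' = S) :
    (∃ γ : O11, ∃ ε : ℤ, (ε = 1 ∨ ε = -1) ∧ ¬ π ∣ γ ∧ (γ = α ∨ π ∣ α ∧ γ = α - ε) ∧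
      S = hemisphere ((γ : ℂ) / π) (1 / ‖(π : ℂ)‖)) ∨
    ∃ β : O11, ∃ c ∈ smallCenters π, α = π * β ∧ S = hemisphere (c + β) (smallRadius π) := by
  obtain ⟨c, d, hc, hcd, rfl⟩ := (mem_isometricSpheres hπ.ne_zero).mp hS
  rw [mem_column hπ.ne_zero] at hx
  rw [mem_exteriorRegion hπ.ne_zero] at hB
  rw [mem_rowSphere hπ.ne_zero hc] at hxS
  obtain ⟨ε, κ, v, v', a, b, w, hε, h, ha, hb, hab, hP⟩ := exists_tile hx
  obtain ⟨h1, h2⟩ := faceRow_valid (α := α) hπ h hε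
  rw [hP] at hB hxS
  have h3 := herm_face_eq_one hπ h hε ha hb hab hB hc hcd hxS
  rw [← hP] at h3
  have h4 := huniq _ ((mem_isometricSpheres hπ.ne_zero).mpr ⟨_, _, h1, h2, rfl⟩)
    ((mem_rowSphere hπ.ne_zero h1).mpr h3)
  rw [← h4, rowSphere]
  rcases face_cases (α := α) hπ h hε with ⟨γ, k1, k2, k3, k4⟩ | ⟨β, c, k1, k2, k3, k4⟩
  · exact .inl ⟨γ, ε, hε, k1, k2, by rw [k3, k4]⟩
  · exact .inr ⟨β, c, k1, k2, by rw [k3, k4]⟩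

theorem exteriorRegion_eq {π : O11} (hπ : Prime π) :
    exteriorRegion π =
        {x | (∀ α : O11, ¬ π ∣ α → x ∈ outside ((α : ℂ) / (π : ℂ)) (1 / ‖(π : ℂ)‖)) ∧
          ∀ β : O11, ∀ c ∈ smallCenters π, x ∈ outside (c + (β : ℂ)) (smallRadius π)} := by
  ext x
  constructor
  · intro hx
    rw [mem_exteriorRegion hπ.ne_zero] at hx
    constructor
    · intro α hα
      have := (mem_outside_row hπ.ne_zero one_ne_zero).mpr
        (hx 1 (-α) one_ne_zero (isCoprime_unit hπ hα))
      simpa using this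
    · intro β c hc
      obtain ⟨ε, κ, hε, hκ, rfl⟩ := mem_smallCenters.mp hc
      obtain ⟨v, v', h⟩ := exists_isTriangle hκ
      rw [← center_face hπ.ne_zero h.ne_zero, ← smallRadius_eq hκ]
      exact (mem_outside_row hπ.ne_zero h.ne_zero).mpr
        (hx _ _ h.ne_zero (isCoprime_face (dvd_mul_right π β) hε))
  · rintro ⟨hbig, hsmall⟩
    rw [mem_exteriorRegion hπ.ne_zero]
    obtain ⟨α, hα⟩ := exists_hex (scaled π x).1
    obtain ⟨ε, κ, v, v', a, b, w, hε, h, ha, hb, hab, hP⟩ := exists_tile hα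
    obtain ⟨h1, h2⟩ := faceRow_valid (α := α) hπ h hε
    -- By `tile_mem`, the single inequality of `faceRow` over the triangle containing the point
    -- implies all the others.
    have h3 : 1 ≤ herm (faceRow π α κ ε).1 (faceRow π α κ ε).2 (scaled π x) := by
      rw [← mem_outside_row hπ.ne_zero h1]
      rcases face_cases (α := α) hπ h hε with ⟨γ, k1, k2, k3, k4⟩ | ⟨β, c, k1, k2, k3, k4⟩
      · rw [k3, k4]
        exact hbig γ k1
      · rw [k3, k4]
        exact hsmall β c k1
    rw [hP] at h3 ⊢
    rw [tile_mem hπ h hε ha hb hab]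
    rw [herm_faceRow h hε] at h3
    have h4 := one_le_normSq h1
    nlinarith

/-- The witness is the top of the sphere. Another sphere through it needs `|cα + d|² + |c|² = 1`,
which leaves only `c = ±1`, `d = -cα`. -/
theorem unit_face {π : O11} (hπ : Prime π) (α : O11) :
    ∃ x ∈ exteriorRegion π, x ∈ column π α ∧ x ∈ hemisphere ((α : ℂ) / π) (1 / ‖(π : ℂ)‖) ∧
      ∀ S' ∈ isometricSpheres π, x ∈ S' → S' = hemisphere ((α : ℂ) / π) (1 / ‖(π : ℂ)‖) := by
  obtain ⟨x, hx⟩ := exists_scaled hπ.ne_zero (u := α) one_pos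
  refine ⟨x, ?_, ?_, ?_, ?_⟩
  · rw [mem_exteriorRegion hπ.ne_zero, hx]
    exact high_mem_aboveAll π le_rfl
  · rw [mem_column hπ.ne_zero, hx]
    simp [Hex]
  · rw [← rowSphere_unit, mem_rowSphere hπ.ne_zero one_ne_zero, hx, herm_lift]
    simp
  · intro S' hS' hxS'
    obtain ⟨c, d, hc, hcd, rfl⟩ := (mem_isometricSpheres hπ.ne_zero).mp hS'
    rw [mem_rowSphere hπ.ne_zero hc, hx, herm_lift] at hxS'
    have h1 := one_le_normSq hc
    have h2 := Complex.normSq_nonneg (c * α + d : ℂ)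
    have h3 : c * α + d = 0 := by
      have : Complex.normSq (c * α + d : ℂ) = 0 := by linarith
      exact Subtype.ext (by simpa using this)
    have h4 : d = -(c * α) := by linear_combination h3
    rw [← rowSphere_unit, h4]
    rcases eq_of_normSq_eq_one (x := c) (by linarith) with rfl | rfl
    · simp
    · rw [← rowSphere_neg]
      simp

/-- Each equation puts `c` on a circle through `0`, centred at minus the conjugate of `v` or `v'`.
The two circles have only one further point in common. -/
theorem IsTriangle.eq_of_re_mul {κ : O11} {v v' c : ℂ} (h : IsTriangle κ v v') (hc : c ≠ 0)
    (h1 : 2 * (c * v).re = -Complex.normSq c) (h2 : 2 * (c * v').re = -Complex.normSq c) :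
    c = κ := by
  obtain ⟨p, y⟩ := c
  obtain ⟨q, rfl⟩ : ∃ q, y = √11 * q := ⟨y / √11, by field_simp [sqrt_pos.ne']⟩
  have hs := sqrt_sq
  have hq : q ≠ 0 ∨ p ≠ 0 := by
    by_contra! h0
    exact hc (by rw [h0.1, h0.2, mul_zero]; rfl)
  have e (r : ℝ) : √11 * q * (r * √11 / 11) = r * q := by linear_combination (r * q / 11) * hs
  have e' (r : ℝ) : √11 * q * (r * √11 / 22) = r * q / 2 := by
    linear_combination (r * q / 22) * hs
  have e'' : √11 * q * (√11 * q) = 11 * q ^ 2 := by linear_combination q ^ 2 * hs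
  rcases h with ⟨rfl, rfl, rfl⟩ | ⟨rfl, rfl, rfl⟩ | ⟨rfl, rfl, rfl⟩
  · rw [corner1_eq, Complex.normSq_mk] at h1
    rw [corner2_coord, Complex.normSq_mk] at h2
    simp only [Complex.mul_re, e, e', e''] at h1 h2
    have hp : p = q := by linarith
    subst hp
    have : p = 1 / 2 := by
      apply mul_left_cancel₀ (show p ≠ 0 by tauto)
      linarith
    subst this
    apply Complex.ext <;> simp [om_re, om_im] <;> norm_num
    ring
  · rw [corner2_coord, Complex.normSq_mk] at h1
    rw [corner3_coord, Complex.normSq_mk] at h2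
    simp only [Complex.mul_re, Complex.neg_re, mul_neg, e', e''] at h1 h2
    have hq0 : q = 0 := by linarith
    subst hq0
    have : p = 1 := by
      apply mul_left_cancel₀ (show p ≠ 0 by tauto)
      linarith
    subst this
    apply Complex.ext <;> simp
  · rw [corner1_eq, Complex.normSq_mk] at h1
    rw [corner3_coord, Complex.normSq_mk] at h2
    simp only [Complex.mul_re, e, e', e''] at h1 h2
    have hp : p = -q := by linarith
    subst hp
    have : q = 1 / 2 := by
      apply mul_left_cancel₀ (show q ≠ 0 by rcases hq with h | h <;> simpa using h)
      linarith
    subst this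
    apply Complex.ext <;> simp [om_re, om_im] <;> norm_num
    ring

/-- The witness lies over the barycentre of a triangle. A plane through it that is nowhere above the
three vertices must contain all of them, and only the row `±(κ, 1)`, moved to `α`, does so. -/
theorem small_face {π : O11} (hπ : Prime π) (β : O11) {c : ℂ} (hc : c ∈ smallCenters π) :
    ∃ x ∈ exteriorRegion π, x ∈ column π (π * β) ∧ x ∈ hemisphere (c + β) (smallRadius π) ∧
      ∀ S' ∈ isometricSpheres π, x ∈ S' → S' = hemisphere (c + β) (smallRadius π) := by
  obtain ⟨ε, κ, hε, hκ, rfl⟩ := mem_smallCenters.mp hc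
  obtain ⟨v, v', h⟩ := exists_isTriangle hκ
  rw [← rowSphere_small hπ.ne_zero hκ]
  set α := π * β with hα
  have hdvd : π ∣ α := dvd_mul_right π β
  have happ : apex π α = 0 := if_pos hdvd
  have hrow : faceRow π α κ ε = (κ, -κ * α + ε) := if_pos hdvd
  set u : ℂ := ((1 / 3 : ℝ) : ℂ) * v + ((1 / 3 : ℝ) : ℂ) * v' with hu
  set P := rel α ε (u, 2 / 3) with hP
  -- Both corners have squared modulus `9/11`, so `|u|² ≤ 4/11 < 2/3` and the witness is above the
  -- paraboloid.
  have hs : 0 < 2 / 3 - Complex.normSq u := by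
    have h1 := normSq_corner h.mem.1
    have h2 := normSq_corner h.mem.2
    have h3 := Complex.normSq_nonneg (v - v')
    have h4 : u = ((1 / 3 : ℝ) : ℂ) * (v + v') := by rw [hu]; ring
    rw [h4, map_mul, Complex.normSq_ofReal, Complex.normSq_add]
    rw [Complex.normSq_sub] at h3
    linarith
  obtain ⟨x, hx⟩ := exists_scaled hπ.ne_zero (u := α + ε * u) hs
  rw [← rel_lift _ _ hε, add_sub_cancel, ← hP] at hx
  have hmem : P ∈ aboveAll π := by
    rw [hP, hu, tile_mem hπ h hε (by norm_num) (by norm_num) (by norm_num), happ]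
    norm_num
  refine ⟨x, ?_, ?_, ?_, ?_⟩
  · rwa [mem_exteriorRegion hπ.ne_zero, hx]
  · rw [← MulMemClass.coe_mul, ← hα, mem_column hπ.ne_zero, hx, hP]
    simp only [rel, add_sub_cancel_left]
    have hv := hex_of_mem (sign_mul_mem_sixPoints h.mem.1 hε)
    have hv' := hex_of_mem (sign_mul_mem_sixPoints h.mem.2 hε)
    have h0 : Hex 0 := by simp [Hex]
    have h1 := convex_hex hv hv' (by norm_num : (0 : ℝ) ≤ 1 / 2) (by norm_num : (0 : ℝ) ≤ 1 / 2)
      (by norm_num)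
    have h2 := convex_hex h1 h0 (by norm_num : (0 : ℝ) ≤ 2 / 3) (by norm_num : (0 : ℝ) ≤ 1 / 3)
      (by norm_num)
    convert h2 using 1
    simp [hu]
    ring_nf
  · rw [mem_rowSphere hπ.ne_zero h.ne_zero, hx, hP, hu]
    have := herm_faceRow (π := π) (α := α) h hε (1 / 3) (1 / 3) (2 / 3)
    rw [hrow, happ] at this
    rw [this]
    norm_num
  · intro S' hS' hxS'
    obtain ⟨c, d, hc, hcd, rfl⟩ := (mem_isometricSpheres hπ.ne_zero).mp hS'
    rw [mem_rowSphere hπ.ne_zero hc, hx, hP, hu] at hxS'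
    have h1 := corner_mem (π := π) (α := α) h.mem.1 hε c d hc hcd
    have h2 := corner_mem (π := π) (α := α) h.mem.2 hε c d hc hcd
    have h3 := apex_mem (α := α) hπ ε c d hc hcd
    have h4 := rel_combo α ε v v' (1 / 3) (1 / 3) 0 1 1
    rw [show (1 / 3 * 1 + 1 / 3 * 1 + (1 - 1 / 3 - 1 / 3) * 0 : ℝ) = 2 / 3 by norm_num] at h4
    rw [happ] at h3
    rw [h4, herm_combo₃] at hxS'
    have k1 : herm c d (rel α ε (v, 1)) = 1 := by linarith
    have k2 : herm c d (rel α ε (v', 1)) = 1 := by linarith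
    have k3 : herm c d (rel α ε (0, 0)) = 1 := by linarith
    rw [herm_rel _ _ _ hε] at k1 k2 k3
    obtain ⟨e, he⟩ : ∃ e : O11, e = ε * (d + c * α) := ⟨_, rfl⟩
    have hd : d = -c * α + ε * e := by
      rw [he]
      rcases hε with rfl | rfl <;> push_cast <;> ring
    have he' : (ε * (d + c * α) : ℂ) = e := by rw [he]; push_cast; rfl
    rw [he'] at k1 k2 k3
    simp only [herm, mul_zero, zero_mul, Complex.zero_re, zero_add] at k3
    rcases eq_of_normSq_eq_one k3 with rfl | rfl
    · have : c = κ := by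
        apply Subtype.ext
        apply h.eq_of_re_mul (coe_ne_zero hc)
        · simp [herm] at k1 ⊢; linarith
        · simp [herm] at k2 ⊢; linarith
      rw [hd, this, mul_one]
    · have : -c = κ := by
        apply Subtype.ext
        apply h.eq_of_re_mul (coe_ne_zero (neg_ne_zero.mpr hc))
        · simp [herm] at k1 ⊢; linarith
        · simp [herm] at k2 ⊢; linarith
      rw [← rowSphere_neg, hd, this, ← this]
      congr 1
      ring

theorem small_mem_isometricSpheres {π : O11} (hπ : Prime π) (β : O11) {c : ℂ}
    (hc : c ∈ smallCenters π) : hemisphere (c + β) (smallRadius π) ∈ isometricSpheres π := by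
  obtain ⟨ε, κ, hε, hκ, rfl⟩ := mem_smallCenters.mp hc
  obtain ⟨v, v', h⟩ := exists_isTriangle hκ
  rw [← rowSphere_small hπ.ne_zero hκ]
  exact (mem_isometricSpheres hπ.ne_zero).mpr
    ⟨_, _, h.ne_zero, isCoprime_face (dvd_mul_right π β) hε, rfl⟩

/-! ### Visible spheres and the faces of the Ford domain. -/

theorem visibleSpheres_eq {π : O11} (hπ : Prime π) :
    visibleSpheres π =
        {S | ∃ α : O11, ¬ π ∣ α ∧ S = hemisphere ((α : ℂ) / (π : ℂ)) (1 / ‖(π : ℂ)‖)} ∪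
        {S | ∃ β : O11, ∃ c ∈ smallCenters π, S = hemisphere (c + (β : ℂ)) (smallRadius π)} := by
  ext S
  constructor
  · rintro ⟨hS, x, ⟨hxS, hxB⟩, huniq⟩
    obtain ⟨α, hα⟩ := exists_hex (scaled π x).1
    rcases face_of_mem_column hπ ((mem_column hπ.ne_zero).mpr hα) hxB hS hxS huniq with
      ⟨γ, -, -, h1, -, h2⟩ | ⟨β, c, h1, -, h2⟩
    · exact .inl ⟨γ, h1, h2⟩
    · exact .inr ⟨β, c, h1, h2⟩
  · rintro (⟨α, hα, rfl⟩ | ⟨β, c, hc, rfl⟩)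
    · obtain ⟨x, h1, -, h2, h3⟩ := unit_face hπ α
      exact ⟨unit_mem_isometricSpheres hπ hα, x, ⟨h2, h1⟩, h3⟩
    · obtain ⟨x, h1, -, h2, h3⟩ := small_face hπ β hc
      exact ⟨small_mem_isometricSpheres hπ β hc, x, ⟨h2, h1⟩, h3⟩

theorem smallCenters_eq {π : O11} (hπ : Prime π) :
    {c : ℂ | hemisphere c (smallRadius π) ∈ visibleSpheres π ∧ ‖c‖ = smallRadius π} =
      smallCenters π := by
  have hr := smallRadius_pos hπ.ne_zero
  have hN := nrm_pos hπ.ne_zero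
  have hr2 : smallRadius π ^ 2 = 1 / (3 * nrm π) := by
    rw [smallRadius, div_pow, Real.sq_sqrt (by positivity), one_pow]
  ext c
  constructor
  · rintro ⟨hv, hc⟩
    rw [visibleSpheres_eq hπ] at hv
    rcases hv with ⟨α, -, h⟩ | ⟨β, c', hc', h⟩
    · have h0 : 0 < 1 / ‖(π : ℂ)‖ := by simpa using hπ.ne_zero
      have h1 := (hemisphere_inj hr h0 h).2
      have h2 : smallRadius π ^ 2 = 1 / nrm π := by rw [h1, nrm, div_pow, one_pow]
      rw [hr2] at h2
      field_simp at h2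
      norm_num at h2
    · obtain ⟨rfl, -⟩ := hemisphere_inj hr hr h
      obtain ⟨ε, κ, hε, hκ, rfl⟩ := mem_smallCenters.mp hc'
      obtain ⟨v, v', ht⟩ := exists_isTriangle hκ
      have hκ0 := coe_ne_zero ht.ne_zero
      have hπ0 := coe_ne_zero hπ.ne_zero
      have hκ3 : (κ * conjO κ : O11) = 3 := by
        apply Subtype.ext
        change (κ : ℂ) * conj (κ : ℂ) = 3
        rw [Complex.mul_conj]
        rcases hκ with rfl | rfl
        · rw [coe_omO, normSq_om]; norm_num
        · push_cast; rw [coe_omO, normSq_om_add_one]; norm_num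
      have hκ3' : (κ : ℂ) * (conjO κ : ℂ) = 3 := congrArg Subtype.val hκ3
      have key : ((3 * (-ε / (κ * π) + β) * π : ℂ)) =
          ((-ε * conjO κ + 3 * π * β : O11) : ℂ) := by
        have : ((3 : O11) : ℂ) = 3 := rfl
        push_cast
        rw [this]
        field_simp
        linear_combination (ε : ℂ) * hκ3'
      -- Multiplication by `3π` turns the centre into an element of `ℤ[ω]` of norm `9N · 1/(3N) =
      -- 3`, and there are only four of these.
      have hn : Complex.normSq ((-ε * conjO κ + 3 * π * β : O11) : ℂ) = 3 := by
        rw [← key, Complex.normSq_eq_norm_sq, norm_mul, norm_mul, hc, mul_pow, mul_pow, hr2,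
          ← nrm]
        field_simp
        norm_num
      have hform : (-ε / (κ * π) + β : ℂ) = ((-ε * conjO κ + 3 * π * β : O11) : ℂ) / (3 * π) := by
        rw [← key]
        field_simp
      rw [hform]
      have hω : (om * (-1 - om) : ℂ) = 3 := by linear_combination -om_mul_self
      rcases eq_of_normSq_eq_three hn with h' | h' | h' | h' <;> rw [h', mem_smallCenters]
      · refine ⟨1, omO + 1, by simp, by simp, ?_⟩
        have := om_add_one_ne_zero
        push_cast
        rw [coe_omO]
        field_simp
        linear_combination -hω
      · refine ⟨-1, omO + 1, by simp, by simp, ?_⟩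
        have := om_add_one_ne_zero
        push_cast
        rw [coe_omO]
        field_simp
        linear_combination hω
      · refine ⟨1, omO, by simp, by simp, ?_⟩
        have := om_ne_zero
        push_cast
        rw [coe_omO]
        field_simp
        linear_combination -hω
      · refine ⟨-1, omO, by simp, by simp, ?_⟩
        have := om_ne_zero
        push_cast
        rw [coe_omO]
        field_simp
        linear_combination hω
  · intro hc
    refine ⟨?_, ?_⟩
    · rw [visibleSpheres_eq hπ]
      exact .inr ⟨0, c, hc, by simp⟩
    · obtain ⟨ε, κ, hε, hκ, rfl⟩ := mem_smallCenters.mp hc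
      rw [← smallRadius_eq hκ, norm_div, mul_comm]
      rcases hε with rfl | rfl <;> simp

theorem faceSpheres_fordDomain {p : ℕ} (hp : p.Prime) (hodd : p ≠ 2) {π : O11} (hπ : Prime π)
    (hdvd : π ∣ (p : O11)) :
    faceSpheres π (fordDomain π p) =
        {S | ∃ ρ ∈ representatives p, ρ ≠ 0 ∧ S = hemisphere (ρ / (π : ℂ)) (1 / ‖(π : ℂ)‖)} ∪
        {S | ∃ c ∈ smallCenters π, S = hemisphere c (smallRadius π)} := by
  ext S
  constructor
  · rintro ⟨hS, x, ⟨hxS, hxB, hxF⟩, huniq⟩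
    simp only [fundInf, Set.mem_iUnion] at hxF
    obtain ⟨ρ, hρ, hxρ⟩ := hxF
    obtain ⟨r, rfl⟩ := exists_coe_of_mem_representatives hρ
    have hr := dvd_representative hp hπ hdvd hρ
    rcases face_of_mem_column hπ hxρ hxB hS hxS huniq with
      ⟨γ, ε, hε, h1, rfl | ⟨h2, rfl⟩, h3⟩ | ⟨β, c, h1, rfl, h2⟩
    · refine .inl ⟨γ, hρ, ?_, h3⟩
      simpa [hr] using h1
    -- In the hexagon around `0` the remaining large spheres are those of `±1`, which are
    -- representatives because `p ≥ 3`.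
    · rw [hr] at h2
      subst h2
      refine .inl ⟨((-ε : ℤ) : ℂ), sign_mem_representatives hp hodd (by omega), ?_, ?_⟩
      · rcases hε with rfl | rfl <;> simp
      · simpa using h3
    · have : β = 0 := by simpa [hπ.ne_zero] using hr
      subst this
      exact .inr ⟨c, h1, by simpa using h2⟩
  · rintro (⟨ρ, hρ, hρ0, rfl⟩ | ⟨c, hc, rfl⟩)
    · obtain ⟨r, rfl⟩ := exists_coe_of_mem_representatives hρ
      have hr : ¬ π ∣ r := by
        rw [dvd_representative hp hπ hdvd hρ]
        simpa using hρ0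
      obtain ⟨x, h1, h2, h3, h4⟩ := unit_face hπ r
      exact ⟨unit_mem_isometricSpheres hπ hr, x,
        ⟨h3, h1, Set.mem_biUnion hρ h2⟩, h4⟩
    · have hz := zero_mem_representatives hp
      have h0 := small_mem_isometricSpheres hπ 0 hc
      obtain ⟨x, h1, h2, h3, h4⟩ := small_face hπ 0 hc
      simp only [ZeroMemClass.coe_zero, add_zero, mul_zero] at h0 h2 h3 h4
      exact ⟨h0, x, ⟨h3, h1, Set.mem_biUnion hz h2⟩, h4⟩

/-! ## Vertices -/

/-- The linear map from Klein coordinates to scaled Klein coordinates. -/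
def kleinScale (π : O11) (hπ : π ≠ 0) : (ℂ × ℝ) ≃ₗ[ℝ] (ℂ × ℝ) :=
  LinearEquiv.prodCongr
    ((LinearEquiv.smulOfNeZero ℂ ℂ (π : ℂ) (coe_ne_zero hπ)).restrictScalars ℝ)
    (LinearEquiv.smulOfNeZero ℝ ℝ (nrm π) (nrm_pos hπ).ne')

theorem kleinScale_klein {π : O11} (hπ : π ≠ 0) (x : H3) :
    kleinScale π hπ (klein x.1) = scaled π x := rfl

/-- The image of the exterior region in scaled Klein coordinates. -/
def kleinRegion (π : O11) : Set (ℂ × ℝ) := {P ∈ aboveAll π | Complex.normSq P.1 < P.2}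

theorem normSq_lt_scaled {π : O11} (hπ : π ≠ 0) (x : H3) :
    Complex.normSq (scaled π x).1 < (scaled π x).2 := by
  have := mul_pos (nrm_pos hπ) (pow_pos x.2 2)
  rw [scaled_eq]
  dsimp only
  linarith

theorem exists_scaled_eq {π : O11} (hπ : π ≠ 0) {P : ℂ × ℝ} (hP : Complex.normSq P.1 < P.2) :
    ∃ x : H3, scaled π x = P := by
  obtain ⟨x, hx⟩ := exists_scaled hπ (u := P.1) (sub_pos.mpr hP)
  exact ⟨x, by rw [hx, add_sub_cancel]⟩

theorem mem_vertices {π : O11} (hπ : π ≠ 0) {x : H3} :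
    x ∈ vertices (exteriorRegion π) ↔ scaled π x ∈ Set.extremePoints ℝ (kleinRegion π) := by
  have h : kleinRegion π =
      kleinScale π hπ '' ((fun y : H3 => klein y.1) '' exteriorRegion π) := by
    rw [Set.image_image]
    simp only [kleinScale_klein]
    ext P
    constructor
    · rintro ⟨h1, h2⟩
      obtain ⟨y, rfl⟩ := exists_scaled_eq hπ h2
      exact ⟨y, (mem_exteriorRegion hπ).mpr h1, rfl⟩
    · rintro ⟨y, hy, rfl⟩
      exact ⟨(mem_exteriorRegion hπ).mp hy, normSq_lt_scaled hπ y⟩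
  rw [h, ← image_extremePoints, ← kleinScale_klein hπ,
    (kleinScale π hπ).injective.mem_set_image]
  rfl

/-- Being above the paraboloid is an open condition, so a short segment along `D` centred at `P`
stays in the region. -/
theorem not_extreme {π : O11} {P D : ℂ × ℝ} (hD : D ≠ 0)
    (h : ∀ᶠ δ in nhds (0 : ℝ), P + δ • D ∈ aboveAll π) :
    P ∉ Set.extremePoints ℝ (kleinRegion π) := by
  intro hP
  have hU : ∀ᶠ δ in nhds (0 : ℝ), Complex.normSq (P + δ • D).1 < (P + δ • D).2 := by
    have hc : Continuous fun δ : ℝ => P + δ • D := by fun_prop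
    have ho : IsOpen {Q : ℂ × ℝ | Complex.normSq Q.1 < Q.2} :=
      isOpen_lt (Complex.continuous_normSq.comp continuous_fst) continuous_snd
    exact hc.continuousAt.eventually (ho.mem_nhds (by simpa using hP.1.2))
  have hneg : Filter.Tendsto (fun δ : ℝ => -δ) (nhds 0) (nhds 0) := by
    simpa using (continuous_neg (G := ℝ)).tendsto 0
  obtain ⟨r, hr, hball⟩ := Metric.eventually_nhds_iff.mp
    ((h.and hU).and (hneg.eventually (h.and hU)))
  obtain ⟨⟨h1, h2⟩, h3, h4⟩ := hball (y := r / 2) (by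
    rw [Real.dist_eq, sub_zero, abs_of_pos (by linarith)]; linarith)
  have hseg : P ∈ openSegment ℝ (P + (r / 2) • D) (P + (-(r / 2)) • D) := by
    refine ⟨1 / 2, 1 / 2, by norm_num, by norm_num, by norm_num, ?_⟩
    module
  have := hP.2 ⟨h1, h2⟩ ⟨h3, h4⟩ hseg
  rw [add_eq_left, smul_eq_zero] at this
  rcases this with h | h
  · linarith
  · exact hD h

theorem rel_line (α : ℂ) (ε : ℤ) (q e : ℂ) (w f δ : ℝ) :
    rel α ε (q + δ * e, w + δ * f) =
      rel α ε (q, w) + δ • ((ε * e, 2 * ε * (e * conj α).re + f) : ℂ × ℝ) := by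
  apply Prod.ext
  · simp [rel]; ring
  · simp [rel]; ring

theorem rel_sign (α : ℂ) {ε : ℤ} (v : ℂ) (w : ℝ) : rel α ε (v, w) = rel α 1 (ε * v, w) := by
  simp [rel]
  ring

theorem IsTriangle.combo_ne_zero {κ : O11} {v v' : ℂ} (h : IsTriangle κ v v') {a b : ℝ}
    (hab : a + b ≠ 0) : (a * v + b * v' : ℂ) ≠ 0 := by
  intro h0
  have h1 : ((κ : ℂ) * (a * v + b * v')).re = a * (κ * v).re + b * (κ * v').re := by
    rw [← Complex.re_ofReal_mul, ← Complex.re_ofReal_mul, ← Complex.add_re]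
    congr 1
    ring
  rw [h0, mul_zero, Complex.zero_re] at h1
  have h2 : (a + b) * Complex.normSq (κ : ℂ) = 0 := by
    linear_combination a * h.re_mul.1 + b * h.re_mul.2 + 2 * h1
  have := one_le_normSq h.ne_zero
  rcases mul_eq_zero.mp h2 with h3 | h3
  · exact hab h3
  · linarith

theorem IsTriangle.ne {κ : O11} {v v' : ℂ} (h : IsTriangle κ v v') : v - v' ≠ 0 := by
  intro h0
  have h1 := congrArg Complex.re h0
  have h2 := congrArg Complex.im h0
  have := sqrt_pos
  rcases h with ⟨-, rfl, rfl⟩ | ⟨-, rfl, rfl⟩ | ⟨-, rfl, rfl⟩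
  · rw [corner1_eq, corner2_coord] at h1
    norm_num at h1
  · rw [corner2_coord, corner3_coord] at h2
    simp at h2
  · rw [corner1_eq, corner3_coord] at h1
    norm_num at h1

theorem extreme_eq_corner {π α : O11} (hπ : Prime π) {P : ℂ × ℝ}
    (hP : P ∈ Set.extremePoints ℝ (kleinRegion π)) (hα : Hex (P.1 - α)) :
    ∃ v ∈ sixPoints, P = rel α 1 (v, 1) := by
  obtain ⟨ε, κ, v, v', a, b, w, hε, h, ha, hb, hab, rfl⟩ := exists_tile hα
  have hε0 : (ε : ℂ) ≠ 0 := by rcases hε with rfl | rfl <;> simp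
  have hw := (tile_mem hπ h hε ha hb hab w).mp hP.1.1
  have nhds_pos : ∀ {x y : ℝ}, 0 < x → ∀ᶠ δ in nhds (0 : ℝ), 0 < x + δ * y := by
    intro x y hx
    have hc : Continuous fun δ : ℝ => x + δ * y := by fun_prop
    exact hc.continuousAt.eventually (lt_mem_nhds (by simpa using hx))
  rcases hw.lt_or_eq with hw | rfl
  -- Strictly above the tent, the point can move vertically.
  · refine absurd hP (not_extreme (D := (ε * 0, 2 * ε * (0 * conj (α : ℂ)).re + 1)) ?_ ?_)
    · simp
    · filter_upwards [nhds_pos (y := 1) (sub_pos.mpr hw)] with δ hδ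
      rw [← rel_line, mul_zero, add_zero, tile_mem hπ h hε ha hb hab]
      linarith
  rcases hab.lt_or_eq with hab' | hab'
  · by_cases h0 : a + b = 0
    · obtain rfl : a = 0 := by linarith
      obtain rfl : b = 0 := by linarith
      have hs : apex π α = 1 := by
        unfold apex
        split_ifs with hd
        · have := hP.1.2
          simp [rel, apex, hd] at this
        · rfl
      rw [hs] at hP
      have hv : v ≠ 0 := by simpa using h.combo_ne_zero (a := 1) (b := 0) (by norm_num)
      -- At the top of a large sphere the tent is flat around the centre: movement towards `v` stays
      -- in this triangle, movement away from it in the opposite one.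
      refine absurd hP (not_extreme (D := (ε * v, 2 * ε * (v * conj (α : ℂ)).re + 0)) ?_ ?_)
      · simp [hε0, hv]
      · filter_upwards [Metric.ball_mem_nhds (0 : ℝ) one_pos] with δ hδ
        rw [Metric.mem_ball, Real.dist_eq, sub_zero, abs_lt] at hδ
        rw [← rel_line]
        rcases le_total 0 δ with hδ0 | hδ0
        · have := (tile_mem (α := α) hπ h hε (a := δ) (b := 0) hδ0 le_rfl (by linarith) 1).mpr
            (by rw [hs]; linarith)
          convert this using 2
          simp
        · have := (tile_mem (α := α) (ε := -ε) hπ h (by omega) (a := -δ) (b := 0) (by linarith)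
            le_rfl (by linarith) 1).mpr (by rw [hs]; linarith)
          rw [rel_sign] at this ⊢
          convert this using 2
          simp
    -- Off the edge `v v'` and the apex, the point can move along the segment from the apex through
    -- it.
    · refine absurd hP (not_extreme (D := (ε * (a * v + b * v'),
        2 * ε * ((a * v + b * v') * conj (α : ℂ)).re + (a + b) * (1 - apex π α))) ?_ ?_)
      · simp [hε0, h.combo_ne_zero h0]
      · filter_upwards [nhds_pos (x := 1) (y := 1) one_pos,
          nhds_pos (y := -(a + b)) (sub_pos.mpr hab')] with δ hδ hδ'
        rw [← rel_line]
        have := (tile_mem (α := α) hπ h hε (a := (1 + δ * 1) * a) (b := (1 + δ * 1) * b)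
          (by positivity) (by positivity) (by linarith) _).mpr le_rfl
        convert this using 2
        refine Prod.ext ?_ ?_
        · push_cast
          ring
        · dsimp only
          ring
  · have hw1 : a + b + (1 - a - b) * apex π α = 1 := by
      rw [show 1 - a - b = 0 by linarith]
      linarith
    rcases ha.lt_or_eq with ha' | rfl
    · rcases hb.lt_or_eq with hb' | rfl
      -- Inside the edge `v v'`, the point can move along the edge.
      · refine absurd hP (not_extreme (D := (ε * (v - v'),
          2 * ε * ((v - v') * conj (α : ℂ)).re + 0)) ?_ ?_)
        · simp [hε0, h.ne]
        · filter_upwards [nhds_pos (y := 1) ha', nhds_pos (y := -1) hb'] with δ hδ hδ'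
          rw [← rel_line]
          have := (tile_mem (α := α) hπ h hε (a := a + δ * 1) (b := b + δ * (-1))
            hδ.le hδ'.le (by linarith) _).mpr le_rfl
          convert this using 2
          refine Prod.ext ?_ ?_
          · push_cast
            ring
          · dsimp only
            ring
      · obtain rfl : a = 1 := by linarith
        refine ⟨ε * v, sign_mul_mem_sixPoints h.mem.1 hε, ?_⟩
        rw [rel_sign, hw1]
        simp
    · obtain rfl : b = 1 := by linarith
      refine ⟨ε * v', sign_mul_mem_sixPoints h.mem.2 hε, ?_⟩
      rw [rel_sign, hw1]
      simp

/-! ### The corners are extreme points. -/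

theorem rel_rel (α β : ℂ) (δ : ℤ) (Q : ℂ × ℝ) : rel α 1 (rel β δ Q) = rel (α + β) δ Q := by
  apply Prod.ext
  · simp [rel]; ring
  · simp [rel, Complex.normSq_apply]; ring

theorem exists_rel_eq (α : ℂ) {ε : ℤ} (hε : ε = 1 ∨ ε = -1) (P : ℂ × ℝ) : ∃ Q, P = rel α ε Q := by
  refine ⟨(ε * (P.1 - α), P.2 - (Complex.normSq α +
    2 * ε * ((ε * (P.1 - α)) * conj α).re)), ?_⟩
  apply Prod.ext
  · rcases hε with rfl | rfl <;> simp [rel]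
  · simp [rel]

theorem eq_of_mem_openSegment {π c d : O11} {P P₁ P₂ : ℂ × ℝ} (h : P ∈ openSegment ℝ P₁ P₂)
    (h₁ : P₁ ∈ aboveAll π) (h₂ : P₂ ∈ aboveAll π) (hc : c ≠ 0) (hcd : IsCoprime (π * c) d)
    (hP : herm c d P = 1) : herm c d P₁ = 1 := by
  obtain ⟨a, b, ha, hb, hab, rfl⟩ := h
  rw [herm_combo _ _ _ _ hab] at hP
  have := h₁ c d hc hcd
  have := h₂ c d hc hcd
  nlinarith

/-- Three independent planes of the family pass through the point, and an open segment in the region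
through it must lie in each. The planes come from the three hexagons that meet there, around `α`, `α
+ εω` and `α + ε(ω + 1)`; which ones are available depends on which centres `π` divides. -/
theorem corner1_extreme {π : O11} (hπ : Prime π) (α : O11) {ε : ℤ} (hε : ε = 1 ∨ ε = -1) :
    rel α ε (corner1, 1) ∈ Set.extremePoints ℝ (kleinRegion π) := by
  refine ⟨⟨corner_mem corner1_mem hε, ?_⟩, ?_⟩
  · rw [← normSq_corner corner1_mem, rel_lift _ _ hε]
    simp
  intro P₁ h₁ P₂ h₂ hseg
  obtain ⟨Q, rfl⟩ := exists_rel_eq α hε P₁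
  have key : ∀ c d : O11, c ≠ 0 → IsCoprime (π * c) (-c * α + ε * d) →
      herm c d (corner1, 1) = 1 → herm c d Q = 1 := by
    intro c d hc hcd h1
    have h2 : ((-c * α + ε * d : O11) : ℂ) = -c * α + ε * d := by push_cast; rfl
    have := eq_of_mem_openSegment hseg h₁.1 h₂.1 hc hcd (by rw [h2, herm_rel' _ _ _ hε, h1])
    rwa [h2, herm_rel' _ _ _ hε] at this
  obtain ⟨⟨X, y⟩, w⟩ := Q
  obtain ⟨Y, rfl⟩ : ∃ Y, y = Y * √11 / 11 :=
    ⟨√11 * y, by linear_combination (-y / 11) * sqrt_sq⟩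
  have hs := sqrt_sq
  have f1 : ∀ X Y w : ℝ, herm 1 0 (⟨X, Y * √11 / 11⟩, w) = w := by
    intros; simp [herm]
  have f2 : ∀ X Y w : ℝ, herm (om + 1) 1 (⟨X, Y * √11 / 11⟩, w) = 3 * w + (X - Y) + 1 := by
    intro X Y w
    simp only [herm, normSq_om_add_one]
    simp [om_re, om_im]
    linear_combination (-Y / 11) * hs
  have f3 : ∀ X Y w : ℝ, herm om 1 (⟨X, Y * √11 / 11⟩, w) = 3 * w - (X + Y) + 1 := by
    intro X Y w
    simp only [herm, normSq_om]
    simp [om_re, om_im]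
    linear_combination (-Y / 11) * hs
  have f4 : ∀ X Y w : ℝ, herm 1 (-om) (⟨X, Y * √11 / 11⟩, w) = w - (Y - X) + 3 := by
    intro X Y w
    simp only [herm, Complex.normSq_neg, normSq_om]
    simp [om_re, om_im]
    linear_combination (-Y / 11) * hs
  have f5 : ∀ X Y w : ℝ, herm 1 (-(om + 1)) (⟨X, Y * √11 / 11⟩, w) = w - (X + Y) + 3 := by
    intro X Y w
    simp only [herm, Complex.normSq_neg, normSq_om_add_one]
    simp [om_re, om_im]
    linear_combination (-Y / 11) * hs
  have f6 : ∀ X Y w : ℝ, herm (om + 1) 2 (⟨X, Y * √11 / 11⟩, w) = 3 * w + 2 * (X - Y) + 4 := by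
    intro X Y w
    simp only [herm, normSq_om_add_one]
    simp [om_re, om_im, Complex.normSq_ofNat]
    linear_combination (-2 * Y / 11) * hs
  have f7 : ∀ X Y w : ℝ, herm om 2 (⟨X, Y * √11 / 11⟩, w) = 3 * w - 2 * (X + Y) + 4 := by
    intro X Y w
    simp only [herm, normSq_om]
    simp [om_re, om_im, Complex.normSq_ofNat]
    linear_combination (-2 * Y / 11) * hs
  rw [corner1_eq] at key ⊢
  have unit : ∀ d : O11, ¬ π ∣ α - ε * d → IsCoprime (π * 1) (-1 * α + ε * d) := by
    intro d hd
    have := isCoprime_unit hπ hd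
    convert this using 1
    ring
  have small : ∀ κ l : O11, π ∣ α + ε * l →
      IsCoprime (π * κ) (-κ * α + ε * (1 - κ * l)) := by
    intro κ l hd
    have := isCoprime_face (κ := κ) hd hε
    convert this using 1
    ring
  have ωω := omO_mul_self
  have fin : w = 1 → X = 0 → Y = 3 →
      rel α ε (⟨X, Y * √11 / 11⟩, w) = rel α ε (⟨0, 3 * √11 / 11⟩, 1) := by
    rintro rfl rfl rfl; rfl
  have g1 : ¬ π ∣ α → w = 1 := fun hd => by
    have := key 1 0 one_ne_zero (unit 0 (by simpa using hd)) (by simpa using f1 0 3 1)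
    simpa [f1] using this
  have g2 : π ∣ α → 3 * w + (X - Y) + 1 = 1 := fun hd => by
    have := key (omO + 1) 1 omO_add_one_ne_zero
      (by simpa using small (omO + 1) 0 (by simpa using hd))
      (by push_cast; rw [coe_omO, f2]; norm_num)
    push_cast at this
    rwa [coe_omO, f2] at this
  have g3 : π ∣ α → 3 * w - (X + Y) + 1 = 1 := fun hd => by
    have := key omO 1 omO_ne_zero
      (by simpa using small omO 0 (by simpa using hd))
      (by push_cast; rw [coe_omO, f3]; norm_num)
    push_cast at this
    rwa [coe_omO, f3] at this
  have g4 : ¬ π ∣ α + ε * omO → w - (Y - X) + 3 = 1 := fun hd => by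
    have := key 1 (-omO) one_ne_zero (unit _ (by simpa using hd))
      (by push_cast; rw [coe_omO, f4]; norm_num)
    push_cast at this
    rwa [coe_omO, f4] at this
  have g5 : ¬ π ∣ α + ε * (omO + 1) → w - (X + Y) + 3 = 1 := fun hd => by
    have := key 1 (-(omO + 1)) one_ne_zero
      (unit _ (by rwa [mul_neg, sub_neg_eq_add]))
      (by push_cast; rw [coe_omO, f5]; norm_num)
    push_cast at this
    rwa [coe_omO, f5] at this
  have two : ((2 : O11) : ℂ) = 2 := rfl
  have g6 : π ∣ α + ε * omO → 3 * w + 2 * (X - Y) + 4 = 1 := fun hd => by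
    -- A small sphere at the cusp over `α + εω`. The relation `ω² + ω = -3` turns its row into `(ω +
    -- 1, 2)` in the coordinates at `α`.
    have hcop := isCoprime_face (κ := omO + 1) hd (ε := -ε) (by omega)
    have := key (omO + 1) 2 omO_add_one_ne_zero
      (by
        convert hcop using 1
        push_cast
        linear_combination (ε : O11) * ωω)
      (by push_cast; rw [coe_omO, two, f6]; norm_num)
    push_cast at this
    rwa [coe_omO, two, f6] at this
  have g7 : π ∣ α + ε * (omO + 1) → 3 * w - 2 * (X + Y) + 4 = 1 := fun hd => by
    have hcop := isCoprime_face (κ := omO) hd (ε := -ε) (by omega)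
    have := key omO 2 omO_ne_zero
      (by
        convert hcop using 1
        push_cast
        linear_combination (ε : O11) * ωω)
      (by rw [coe_omO, two, f7]; norm_num)
    rwa [coe_omO, two, f7] at this
  -- These two centres differ by a unit, so they are not both multiples of `π`.
  have hBC : π ∣ α + ε * omO → ¬ π ∣ α + ε * (omO + 1) := by
    intro hB hC
    have := dvd_sub hC hB
    rw [show α + ε * (omO + 1) - (α + ε * omO) = (ε : O11) by ring] at this
    apply hπ.not_isUnit
    apply isUnit_of_dvd_unit this
    rcases hε with rfl | rfl <;> simp
  by_cases hA : π ∣ α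
  · have := g2 hA
    have := g3 hA
    by_cases hB : π ∣ α + ε * omO
    · have := g5 (hBC hB)
      exact fin (by linarith) (by linarith) (by linarith)
    · have := g4 hB
      exact fin (by linarith) (by linarith) (by linarith)
  · have := g1 hA
    by_cases hB : π ∣ α + ε * omO
    · have := g6 hB
      have := g5 (hBC hB)
      exact fin (by linarith) (by linarith) (by linarith)
    · have := g4 hB
      by_cases hC : π ∣ α + ε * (omO + 1)
      · have := g7 hC
        exact fin (by linarith) (by linarith) (by linarith)
      · have := g5 hC
        exact fin (by linarith) (by linarith) (by linarith)

theorem corner_extreme {π : O11} (hπ : Prime π) (α : O11) {v : ℂ} (hv : v ∈ sixPoints) :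
    rel α 1 (v, 1) ∈ Set.extremePoints ℝ (kleinRegion π) := by
  obtain ⟨β, δ, hδ, h⟩ := exists_rel_corner1 hv
  rw [h, rel_rel, ← AddMemClass.coe_add]
  exact corner1_extreme hπ (α + β) hδ

theorem nrm_mul_height_sq {π : O11} (hπ : π ≠ 0) : nrm π * height π ^ 2 = 2 / 11 := by
  have := nrm_pos hπ
  rw [height, Real.sq_sqrt (by positivity)]
  field_simp

theorem kleinScale_corner {π : O11} (hπ : π ≠ 0) {v : ℂ} (hv : v ∈ sixPoints) (α : ℂ) :
    kleinScale π hπ (klein ((v + α) / π, height π)) = rel α 1 (v, 1) := by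
  rw [← normSq_corner hv, rel_lift _ _ (.inl rfl)]
  have h : kleinScale π hπ (klein ((v + α) / π, height π)) =
    (π * ((v + α) / π), nrm π * (‖(v + α) / π‖ ^ 2 + height π ^ 2)) := rfl
  rw [h, mul_div_cancel₀ _ (coe_ne_zero hπ), mul_add, nrm_mul_height_sq hπ, nrm_eq,
    ← Complex.normSq_eq_norm_sq, ← map_mul, mul_div_cancel₀ _ (coe_ne_zero hπ)]
  simp [add_comm]

theorem klein_injective {x y : H3} (h : klein x.1 = klein y.1) : x = y := by
  obtain ⟨⟨z, t⟩, ht⟩ := x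
  obtain ⟨⟨z', t'⟩, ht'⟩ := y
  simp only [klein, Prod.mk.injEq] at h ht ht'
  obtain ⟨rfl, h⟩ := h
  have h2 : t ^ 2 = t' ^ 2 := by linarith
  have : t = t' := (pow_left_inj₀ ht.le ht'.le two_ne_zero).mp h2
  subst this
  rfl

theorem height_pos {π : O11} (hπ : π ≠ 0) : 0 < height π := by
  have := nrm_pos hπ
  unfold height
  positivity

theorem scaled_eq_corner {π : O11} (hπ : π ≠ 0) {v : ℂ} (hv : v ∈ sixPoints) {α : ℂ} {x : H3} :
    scaled π x = rel α 1 (v, 1) ↔ x.1 = ((v + α) / (π : ℂ), height π) := by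
  rw [← kleinScale_corner hπ hv, ← kleinScale_klein hπ, (kleinScale π hπ).injective.eq_iff]
  constructor
  · intro h
    exact congrArg Subtype.val (klein_injective (y := ⟨(_, _), height_pos hπ⟩) h)
  · intro h
    rw [h]

theorem vertices_eq {π : O11} (hπ : Prime π) :
    vertices (exteriorRegion π) =
        {x | ∃ α : O11, ∃ z ∈ sixPoints, x.1 = ((z + (α : ℂ)) / (π : ℂ), height π)} := by
  ext x
  rw [mem_vertices hπ.ne_zero]
  constructor
  · intro hx
    obtain ⟨α, hα⟩ := exists_hex (scaled π x).1
    obtain ⟨v, hv, h⟩ := extreme_eq_corner hπ hx hα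
    exact ⟨α, v, hv, (scaled_eq_corner hπ.ne_zero hv).mp h⟩
  · rintro ⟨α, v, hv, h⟩
    rw [(scaled_eq_corner hπ.ne_zero hv).mpr h]
    exact corner_extreme hπ α hv

theorem vertices_inter_fordDomain {p : ℕ} {π : O11} (hπ : Prime π) :
    vertices (exteriorRegion π) ∩ fordDomain π p =
        {x | ∃ ρ ∈ representatives p, ∃ z ∈ sixPoints,
          x.1 = ((z + ρ) / (π : ℂ), height π)} := by
  ext x
  constructor
  · rintro ⟨hx, hxB, hxF⟩
    rw [mem_vertices hπ.ne_zero] at hx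
    simp only [fundInf, Set.mem_iUnion] at hxF
    obtain ⟨ρ, hρ, hxρ⟩ := hxF
    obtain ⟨r, rfl⟩ := exists_coe_of_mem_representatives hρ
    obtain ⟨v, hv, h⟩ := extreme_eq_corner hπ hx ((mem_column hπ.ne_zero).mp hxρ)
    exact ⟨r, hρ, v, hv, (scaled_eq_corner hπ.ne_zero hv).mp h⟩
  · rintro ⟨ρ, hρ, v, hv, h⟩
    obtain ⟨r, rfl⟩ := exists_coe_of_mem_representatives hρ
    have hs := (scaled_eq_corner hπ.ne_zero hv).mpr h
    refine ⟨?_, ?_, Set.mem_biUnion hρ ?_⟩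
    · rw [mem_vertices hπ.ne_zero, hs]
      exact corner_extreme hπ r hv
    · rw [mem_exteriorRegion hπ.ne_zero, hs]
      exact (corner_extreme hπ r hv).1.1
    · rw [mem_column hπ.ne_zero, hs]
      simpa [rel] using hex_of_mem hv

/-! ## Hyperbolic convex hulls -/

/-- The points of `cellVertices` in scaled Klein coordinates. -/
def hullVertices (r : O11) : Set (ℂ × ℝ) :=
  (fun v => rel r 1 (v, 1)) '' sixPoints ∪ {q | r = 0 ∧ q = (0, 0)}

theorem image_cellVertices {π : O11} (hπ : π ≠ 0) (r : O11) :
    kleinScale π hπ '' (klein '' cellVertices π r) = hullVertices r := by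
  ext q
  simp only [Set.mem_image, cellVertices, hullVertices, cellCorners, Set.mem_union, Set.mem_prod,
    Set.mem_ofPred_eq, Set.mem_singleton_iff]
  constructor
  · rintro ⟨_, ⟨⟨z, t⟩, (⟨⟨v, hv, rfl⟩, rfl⟩ | ⟨h, h'⟩), rfl⟩, rfl⟩
    · exact .inl ⟨v, hv, (kleinScale_corner hπ hv r).symm⟩
    · refine .inr ⟨by simpa using h, ?_⟩
      rw [h', show klein (0, 0) = 0 by simp [klein], map_zero]
      rfl
  · rintro (⟨v, hv, rfl⟩ | ⟨rfl, rfl⟩)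
    · exact ⟨_, ⟨((v + r) / π, height π), .inl ⟨⟨v, hv, rfl⟩, rfl⟩, rfl⟩, kleinScale_corner hπ hv r⟩
    · exact ⟨_, ⟨(0, 0), .inr ⟨rfl, rfl⟩, rfl⟩,
        by rw [show klein (0, 0) = 0 by simp [klein], map_zero]; rfl⟩

theorem mem_hullWithInfty {π : O11} (hπ : π ≠ 0) {r : O11} {x : H3} :
    x ∈ hullWithInfty (cellVertices π r) ↔
      ∃ w ≤ (scaled π x).2, ((scaled π x).1, w) ∈ convexHull ℝ (hullVertices r) := by
  have hN := nrm_pos hπ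
  have himg : convexHull ℝ (hullVertices r) =
      kleinScale π hπ '' convexHull ℝ (klein '' cellVertices π r) := by
    rw [← image_cellVertices hπ]
    exact ((kleinScale π hπ).toLinearMap.image_convexHull _).symm
  rw [himg]
  constructor
  · rintro ⟨w, hw, hmem⟩
    exact ⟨nrm π * w, mul_le_mul_of_nonneg_left hw hN.le, ⟨_, hmem, rfl⟩⟩
  · rintro ⟨w, hw, ⟨z, w'⟩, hmem, heq⟩
    have h1 : π * z = π * x.1.1 := congrArg Prod.fst heq
    have h2 : nrm π * w' = w := congrArg Prod.snd heq
    have h3 : z = x.1.1 := mul_left_cancel₀ (coe_ne_zero hπ) h1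
    subst h3
    refine ⟨w', ?_, hmem⟩
    rw [← h2] at hw
    exact le_of_mul_le_mul_left hw hN

theorem convex_hex_prism (ρ : ℂ) : Convex ℝ {P : ℂ × ℝ | Hex (P.1 - ρ)} := by
  have := (convex_hex.translate_preimage_left (-ρ)).linear_preimage (LinearMap.fst ℝ ℂ ℝ)
  simpa [sub_eq_add_neg, Set.preimage] using this

/-- Both sides are everything above the tent over the hexagon. The condition on `r` ensures that the
only cusp apex is `0`, which `hullVertices` contains. -/
theorem hullWithInfty_eq {π : O11} (hπ : Prime π) {r : O11} (hr : π ∣ r ↔ r = 0) :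
    hullWithInfty (cellVertices π r) = exteriorRegion π ∩ column π r := by
  ext x
  rw [mem_hullWithInfty hπ.ne_zero, Set.mem_inter_iff, mem_exteriorRegion hπ.ne_zero,
    mem_column hπ.ne_zero]
  constructor
  · rintro ⟨w, hw, hmem⟩
    have hsub : convexHull ℝ (hullVertices r) ⊆ aboveAll π ∩ {P : ℂ × ℝ | Hex (P.1 - r)} := by
      refine convexHull_min ?_ ((convex_aboveAll π).inter (convex_hex_prism r))
      rintro _ (⟨v, hv, rfl⟩ | ⟨rfl, rfl⟩)
      · exact ⟨corner_mem hv (.inl rfl), by simpa [rel] using hex_of_mem hv⟩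
      · refine ⟨?_, by simp [Hex]⟩
        simpa using cusp_mem_aboveAll hπ (dvd_zero π)
    obtain ⟨h1, h2⟩ := hsub hmem
    exact ⟨aboveAll_mono hw h1, h2⟩
  · rintro ⟨hB, hH⟩
    obtain ⟨ε, κ, v, v', a, b, w, hε, h, ha, hb, hab, hP⟩ := exists_tile hH
    rw [hP] at hB ⊢
    rw [tile_mem hπ h hε ha hb hab] at hB
    refine ⟨(rel r ε (a * v + b * v', a + b + (1 - a - b) * apex π r)).2, ?_, ?_⟩
    · simp only [rel]
      linarith
    change rel r ε (a * v + b * v', a + b + (1 - a - b) * apex π r) ∈ _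
    have hc := convex_convexHull ℝ (hullVertices r)
    have hcor : ∀ v ∈ sixPoints, rel r ε (v, 1) ∈ convexHull ℝ (hullVertices r) := by
      intro v hv
      rw [rel_sign]
      exact subset_convexHull ℝ _ (.inl ⟨_, sign_mul_mem_sixPoints hv hε, rfl⟩)
    have hapex : rel r ε (0, apex π r) ∈ convexHull ℝ (hullVertices r) := by
      unfold apex
      split_ifs with hd
      · rw [hr] at hd
        subst hd
        apply subset_convexHull ℝ _
        exact .inr ⟨rfl, by simp [rel]⟩
      -- Over a hexagon not centred at a cusp the apex is no extra vertex: it is the midpoint of two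
      -- opposite corners.
      · have := hc (hcor _ corner1_mem) (hcor _ (neg_mem_sixPoints corner1_mem))
          (by norm_num : (0 : ℝ) ≤ 1 / 2) (by norm_num : (0 : ℝ) ≤ 1 / 2) (by norm_num)
        convert this using 1
        apply Prod.ext
        · simp [rel]; ring
        · simp [rel]; ring
    have hsum := rel_combo r ε v v' a b (apex π r) 1 1
    rw [mul_one, mul_one] at hsum
    rw [hsum]
    have := hc.sum_mem (t := Finset.univ) (w := ![a, b, 1 - a - b])
      (z := ![rel r ε (v, 1), rel r ε (v', 1), rel r ε (0, apex π r)])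
      (by intro i _; fin_cases i <;> simp [*]; linarith)
      (by simp [Fin.sum_univ_three])
      (by
        intro i _
        fin_cases i
        · exact hcor _ h.mem.1
        · exact hcor _ h.mem.2
        · exact hapex)
    simpa [Fin.sum_univ_three] using this

theorem fordDomain_eq_hulls {p : ℕ} (hp : p.Prime) {π : O11} (hπ : Prime π)
    (hdvd : π ∣ (p : O11)) :
    fordDomain π p = ⋃ ρ ∈ representatives p, hullWithInfty (cellVertices π ρ) := by
  rw [fordDomain, fundInf, Set.inter_iUnion₂]
  refine Set.iUnion₂_congr fun ρ hρ => ?_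
  obtain ⟨r, rfl⟩ := exists_coe_of_mem_representatives hρ
  exact (hullWithInfty_eq hπ (dvd_representative hp hπ hdvd hρ)).symm

/-! ## The action of `PΓ₀(π)` -/

/-- A matrix over `ℤ[ω]` as a complex matrix. -/
abbrev toC (g : SL(2, O11)) : SL(2, ℂ) := Matrix.SpecialLinearGroup.map (algebraMap O11 ℂ) g

theorem toPSL_smul (g : SL(2, O11)) (x : H3) : toPSL g • x = act (toC g) x := rfl

theorem toC_mul (g h : SL(2, O11)) : toC (g * h) = toC g * toC h := map_mul _ _ _

theorem toC_mul_den (g h : SL(2, O11)) (x : H3) :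
    den (toC (g * h)) x = den (toC g) (toPSL h • x) * den (toC h) x := by
  rw [toPSL_smul, ← den_mul, toC_mul]

theorem height_smul (g : SL(2, O11)) (x : H3) :
    (toPSL g • x).1.2 = x.1.2 / den (toC g) x := rfl

theorem mem_exteriorRegion_den {π : O11} (hπ : π ≠ 0) {x : H3} :
    x ∈ exteriorRegion π ↔ ∀ g ∈ Gamma0 π, g 1 0 ≠ 0 → 1 ≤ den (toC g) x := by
  rw [mem_exteriorRegion hπ]
  constructor
  · rintro hx g ⟨c, hc⟩ h0
    rw [den_eq_herm π c (g 1 1) g hc rfl]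
    refine hx c _ ?_ (hc ▸ isCoprime_row g)
    rintro rfl
    exact h0 (by simpa using hc)
  · intro hx c d hc hcd
    obtain ⟨g, h1, h2⟩ := exists_row hcd
    rw [← den_eq_herm π c d g h1 h2]
    exact hx g ⟨c, h1⟩ (by rw [h1]; exact mul_ne_zero hπ hc)

/-- The translation by `β`. -/
def translation (β : O11) : SL(2, O11) := ⟨!![1, β; 0, 1], by simp [Matrix.det_fin_two_of]⟩

theorem translation_mem (π β : O11) : translation β ∈ GammaInf π := by
  have h : translation β 1 0 = 0 := rfl
  refine ⟨?_, h⟩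
  change π ∣ translation β 1 0
  rw [h]
  exact dvd_zero π

/-- The only units of `ℤ[ω]` are `±1`, so the diagonal is `±(1, 1)` and the stabilizer of `∞` acts
by translations alone. -/
theorem exists_translation {g : SL(2, O11)} (hg : g 1 0 = 0) :
    ∃ β : O11, (∀ x : H3, (toPSL g • x).1 = (x.1.1 + β, x.1.2)) ∧
      (∀ x : H3, den (toC g) x = 1) ∧ (β = 0 → toPSL g = 1) := by
  have hdet := g.det_coe
  rw [Matrix.det_fin_two, hg, mul_zero, sub_zero] at hdet
  have key : ∃ r : O11, (r = 1 ∨ r = -1) ∧ g 0 0 = r ∧ g 1 1 = r := by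
    rcases eq_of_mul_eq_one hdet with ⟨h1, h2⟩ | ⟨h1, h2⟩
    · exact ⟨1, .inl rfl, h1, h2⟩
    · exact ⟨-1, .inr rfl, h1, h2⟩
  obtain ⟨r, hr, h00, h11⟩ := key
  have hden : ∀ x : H3, den (toC g) x = 1 := by
    intro x
    rcases hr with rfl | rfl <;> simp [den, hg, h11]
  refine ⟨r * g 0 1, fun x => ?_, hden, fun h0 => ?_⟩
  · have hnum : num (toC g) x = x.1.1 + (r * g 0 1 : O11) := by
      rcases hr with rfl | rfl <;> (simp [num, hg, h11, h00]; try ring)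
    apply Prod.ext
    · change num (toC g) x / (den (toC g) x : ℂ) = _
      rw [hden, hnum, Complex.ofReal_one, div_one]
    · rw [height_smul, hden, div_one]
  · have h01 : g 0 1 = 0 := by
      rcases hr with rfl | rfl <;> simpa using h0
    rw [toPSL, QuotientGroup.mk'_apply, QuotientGroup.eq_one_iff,
      Matrix.SpecialLinearGroup.mem_center_iff]
    refine ⟨r, by rcases hr with rfl | rfl <;> simp, ?_⟩
    ext i j
    fin_cases i <;> fin_cases j <;> simp [h00, h01, h11, hg]

theorem translation_smul (β : O11) (x : H3) :
    (toPSL (translation β) • x).1 = (x.1.1 + β, x.1.2) := by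
  have h00 : translation β 0 0 = 1 := rfl
  have h01 : translation β 0 1 = β := rfl
  have h10 : translation β 1 0 = 0 := rfl
  have h11 : translation β 1 1 = 1 := rfl
  have hden : den (toC (translation β)) x = 1 := by simp [den, h10, h11]
  have hnum : num (toC (translation β)) x = x.1.1 + β := by simp [num, h10, h11, h00, h01]
  apply Prod.ext
  · change num (toC (translation β)) x / (den (toC (translation β)) x : ℂ) = _
    rw [hden, hnum, Complex.ofReal_one, div_one]
  · rw [height_smul, hden, div_one]

theorem image_hemisphere {γ : PSL2O} {β : O11}
    (hγ : ∀ x : H3, (γ • x).1 = (x.1.1 + β, x.1.2)) (c : ℂ) (r : ℝ) :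
    (fun x : H3 => γ • x) '' hemisphere c r = hemisphere (c + β) r := by
  ext y
  constructor
  · rintro ⟨x, hx, rfl⟩
    simp only [hemisphere, sqDist, Set.mem_ofPred_eq, hγ] at hx ⊢
    rwa [add_sub_add_right_eq_sub]
  · intro hy
    refine ⟨γ⁻¹ • y, ?_, smul_inv_smul γ y⟩
    have h := hγ (γ⁻¹ • y)
    rw [smul_inv_smul] at h
    simp only [hemisphere, sqDist, Set.mem_ofPred_eq, h] at hy ⊢
    rwa [add_sub_add_right_eq_sub] at hy

theorem existsUnique_representative {p : ℕ} (hp : p.Prime) (hodd : p ≠ 2) {π : O11}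
    (hπ : Prime π) (hdvd : π ∣ (p : O11)) {α : O11} (hα : ¬ π ∣ α) :
    ∃! ρ : ℂ, ρ ∈ representatives p ∧ ρ ≠ 0 ∧
        ∃ γ ∈ PGammaInf π, (fun x : H3 => γ • x) '' hemisphere ((α : ℂ) / π) (1 / ‖(π : ℂ)‖) =
            hemisphere (ρ / (π : ℂ)) (1 / ‖(π : ℂ)‖) := by
  have hπ0 := coe_ne_zero hπ.ne_zero
  have hr : 0 < 1 / ‖(π : ℂ)‖ := by simpa using hπ.ne_zero
  obtain ⟨r, hrep, β, hβ⟩ := exists_representative hp hodd hπ hdvd α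
  refine ⟨r, ⟨hrep, ?_, toPSL (translation (-β)), ⟨_, translation_mem π _, rfl⟩, ?_⟩, ?_⟩
  · rintro h0
    have : r = 0 := Subtype.ext h0
    exact hα ⟨β, by rw [← hβ, this, sub_zero]⟩
  · rw [image_hemisphere (translation_smul (-β))]
    congr 1
    have : (α : ℂ) - r = π * β := congrArg Subtype.val hβ
    push_cast
    field_simp
    linear_combination this
  · rintro ρ' ⟨hrep', -, γ, ⟨g, hg, rfl⟩, h⟩
    obtain ⟨r', rfl⟩ := exists_coe_of_mem_representatives hrep'
    obtain ⟨β', hβ', -⟩ := exists_translation hg.2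
    rw [image_hemisphere hβ'] at h
    have h1 := (hemisphere_inj hr hr h).1
    have h2 : r' = α + π * β' := by
      apply Subtype.ext
      push_cast
      field_simp at h1
      rw [← h1]
    rw [representatives_inj hp hπ hdvd hrep' hrep]
    rw [h2, show α + π * β' - r = (α - r) + π * β' by ring, hβ]
    exact dvd_add (dvd_mul_right _ _) (dvd_mul_right _ _)

/-! ## Closures of interiors -/

/-- Upper half-space is homeomorphic to the region above the paraboloid. -/
def scaledHomeo (π : O11) (hπ : π ≠ 0) : H3 ≃ₜ {P : ℂ × ℝ // Complex.normSq P.1 < P.2} where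
  toFun x := ⟨scaled π x, normSq_lt_scaled hπ x⟩
  invFun P := ⟨(P.1.1 / π, √((P.1.2 - Complex.normSq P.1.1) / nrm π)),
    Real.sqrt_pos.mpr (div_pos (sub_pos.mpr P.2) (nrm_pos hπ))⟩
  left_inv x := by
    have hN := (nrm_pos hπ).ne'
    apply Subtype.ext
    dsimp only
    rw [scaled_eq]
    dsimp only
    rw [mul_div_cancel_left₀ _ (coe_ne_zero hπ), add_sub_cancel_left, mul_div_cancel_left₀ _ hN,
      Real.sqrt_sq x.2.le]
  right_inv P := by
    apply Subtype.ext
    dsimp only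
    rw [scaled_eq]
    dsimp only
    rw [mul_div_cancel₀ _ (coe_ne_zero hπ),
      Real.sq_sqrt (div_nonneg (sub_pos.mpr P.2).le (nrm_pos hπ).le),
      mul_div_cancel₀ _ (nrm_pos hπ).ne', add_sub_cancel]
  continuous_toFun := by
    unfold scaled
    fun_prop
  continuous_invFun := by
    have := Complex.continuous_normSq
    fun_prop

theorem continuous_scaled (π : O11) : Continuous (scaled π) := by
  unfold scaled
  fun_prop

theorem isOpenMap_scaled {π : O11} (hπ : π ≠ 0) : IsOpenMap (scaled π) := by
  have h1 : IsOpen {P : ℂ × ℝ | Complex.normSq P.1 < P.2} :=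
    isOpen_lt (Complex.continuous_normSq.comp continuous_fst) continuous_snd
  exact h1.isOpenMap_subtype_val.comp (scaledHomeo π hπ).isOpenMap

theorem closure_interior_preimage {π : O11} (hπ : π ≠ 0) {D : Set (ℂ × ℝ)} (hconv : Convex ℝ D)
    (hclosed : IsClosed D) (hne : (interior D).Nonempty) :
    closure (interior (scaled π ⁻¹' D)) = scaled π ⁻¹' D := by
  rw [← (isOpenMap_scaled hπ).preimage_interior_eq_interior_preimage (continuous_scaled π),
    ← (isOpenMap_scaled hπ).preimage_closure_eq_closure_preimage (continuous_scaled π),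
    hconv.closure_interior_eq_closure_of_nonempty_interior hne, hclosed.closure_eq]

theorem closure_interior_biUnion {X ι : Type*} [TopologicalSpace X] {I : Set ι} (hI : I.Finite)
    {A : ι → Set X} (hA : ∀ i ∈ I, closure (interior (A i)) = A i) :
    closure (interior (⋃ i ∈ I, A i)) = ⋃ i ∈ I, A i := by
  apply Set.Subset.antisymm
  · have hcl : IsClosed (⋃ i ∈ I, A i) :=
      hI.isClosed_biUnion fun i hi => hA i hi ▸ isClosed_closure
    exact (closure_mono interior_subset).trans hcl.closure_eq.subset
  · refine Set.iUnion₂_subset fun i hi => ?_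
    rw [← hA i hi]
    exact closure_mono (interior_mono (Set.subset_biUnion_of_mem hi))

theorem isClosed_hex_prism (ρ : ℂ) : IsClosed {P : ℂ × ℝ | Hex (P.1 - ρ)} := by
  have hre : Continuous fun P : ℂ × ℝ => (P.1 - ρ).re :=
    Complex.continuous_re.comp (continuous_fst.sub continuous_const)
  have him : Continuous fun P : ℂ × ℝ => (P.1 - ρ).im :=
    Complex.continuous_im.comp (continuous_fst.sub continuous_const)
  exact (isClosed_le (continuous_const.mul hre).abs continuous_const).inter
    ((isClosed_le ((continuous_const.mul him).sub hre).abs continuous_const).inter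
      (isClosed_le ((continuous_const.mul him).add hre).abs continuous_const))

theorem mem_interior_prism (π : O11) (ρ : ℂ) :
    (ρ, Complex.normSq ρ + 2) ∈ interior (aboveAll π ∩ {P : ℂ × ℝ | Hex (P.1 - ρ)}) := by
  have hre : Continuous fun P : ℂ × ℝ => (P.1 - ρ).re :=
    Complex.continuous_re.comp (continuous_fst.sub continuous_const)
  have him : Continuous fun P : ℂ × ℝ => (P.1 - ρ).im :=
    Complex.continuous_im.comp (continuous_fst.sub continuous_const)
  have hopen := (isOpen_lt ((Complex.continuous_normSq.comp continuous_fst).add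
      (continuous_const (y := (1 : ℝ)))) (continuous_snd (X := ℂ) (Y := ℝ))).inter
    ((isOpen_lt (continuous_const (y := (2 : ℝ)) |>.mul hre).abs
      (continuous_const (y := (1 : ℝ)))).inter
    ((isOpen_lt ((continuous_const (y := √11) |>.mul him).sub hre).abs
      (continuous_const (y := (3 : ℝ)))).inter
      (isOpen_lt ((continuous_const (y := √11) |>.mul him).add hre).abs
        (continuous_const (y := (3 : ℝ))))))
  refine mem_interior.mpr ⟨_, ?_, hopen, ?_⟩
  · rintro ⟨u, w⟩ ⟨h1, h2, h3, h4⟩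
    exact ⟨high_mem_aboveAll π (le_of_lt h1), le_of_lt h2, le_of_lt h3, le_of_lt h4⟩
  · refine ⟨?_, ?_, ?_, ?_⟩ <;> simp

theorem column_eq {π : O11} (hπ : π ≠ 0) (ρ : ℂ) :
    column π ρ = scaled π ⁻¹' {P : ℂ × ℝ | Hex (P.1 - ρ)} := by
  ext x
  exact mem_column hπ

theorem exteriorRegion_eq_preimage {π : O11} (hπ : π ≠ 0) :
    exteriorRegion π = scaled π ⁻¹' aboveAll π := by
  ext x
  exact mem_exteriorRegion hπ

theorem closure_interior_fundInf {π : O11} (hπ : π ≠ 0) (p : ℕ) :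
    closure (interior (fundInf π p)) = fundInf π p := by
  refine closure_interior_biUnion (finite_representatives p) fun ρ _ => ?_
  rw [column_eq hπ]
  exact closure_interior_preimage hπ (convex_hex_prism ρ) (isClosed_hex_prism ρ)
    ⟨_, interior_mono Set.inter_subset_right (mem_interior_prism π ρ)⟩

theorem closure_interior_fordDomain {π : O11} (hπ : π ≠ 0) (p : ℕ) :
    closure (interior (fordDomain π p)) = fordDomain π p := by
  rw [fordDomain, fundInf, Set.inter_iUnion₂]
  refine closure_interior_biUnion (finite_representatives p) fun ρ _ => ?_
  rw [column_eq hπ, exteriorRegion_eq_preimage hπ, ← Set.preimage_inter]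
  exact closure_interior_preimage hπ ((convex_aboveAll π).inter (convex_hex_prism ρ))
    ((isClosed_aboveAll π).inter (isClosed_hex_prism ρ)) ⟨_, mem_interior_prism π ρ⟩

/-! ## Translates cover -/

theorem covers_fundInf {p : ℕ} (hp : p.Prime) (hodd : p ≠ 2) {π : O11} (hπ : Prime π)
    (hdvd : π ∣ (p : O11)) (x : H3) :
    ∃ β : O11, toPSL (translation β) • x ∈ fundInf π p := by
  obtain ⟨α, hα⟩ := exists_hex (scaled π x).1
  obtain ⟨r, hr, β, hβ⟩ := exists_representative hp hodd hπ hdvd α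
  refine ⟨-β, Set.mem_biUnion hr ?_⟩
  rw [mem_column hπ.ne_zero]
  convert hα using 1
  have : (α : ℂ) - r = π * β := congrArg Subtype.val hβ
  simp only [scaled, translation_smul]
  push_cast
  linear_combination this

/-! ### Moving a point into the exterior region. -/

theorem finite_rows {u : ℂ} {s : ℝ} (hs : 0 < s) :
    {q : O11 × O11 | herm q.1 q.2 (u, Complex.normSq u + s) ≤ 1}.Finite := by
  refine ((finite_norm_le √(1 / s)).prod (finite_norm_le (1 + √(1 / s) * ‖u‖))).subset ?_
  rintro ⟨c, d⟩ h
  simp only [Set.mem_ofPred_eq, herm_lift] at h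
  have h1 := Complex.normSq_nonneg (c * u + d)
  have h2 := mul_nonneg (Complex.normSq_nonneg (c : ℂ)) hs.le
  have hc : ‖(c : ℂ)‖ ≤ √(1 / s) := by
    apply Real.le_sqrt_of_sq_le
    rw [le_div_iff₀ hs, ← Complex.normSq_eq_norm_sq]
    linarith
  have hd : ‖(c * u + d : ℂ)‖ ≤ 1 := by
    rw [← sq_le_one_iff₀ (norm_nonneg _), ← Complex.normSq_eq_norm_sq]
    linarith
  refine ⟨hc, ?_⟩
  have h3 : ‖(d : ℂ)‖ ≤ ‖(c * u + d : ℂ)‖ + ‖(c : ℂ) * u‖ := by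
    have := norm_sub_le (c * u + d : ℂ) (c * u)
    rwa [add_sub_cancel_left] at this
  rw [norm_mul] at h3
  have := mul_le_mul_of_nonneg_right hc (norm_nonneg u)
  simp only [Set.mem_ofPred_eq]
  linarith

/-- Choose `g` minimizing `den`, that is, making the image as high as possible; the minimum exists
because only finitely many rows give a value at most `1`. The cocycle rule for `den` then shows that
no further element raises the image. -/
theorem exists_smul_mem_exteriorRegion {π : O11} (hπ : Prime π) (x : H3) :
    ∃ g ∈ Gamma0 π, toPSL g • x ∈ exteriorRegion π := by
  have hs := mul_pos (nrm_pos hπ.ne_zero) (pow_pos x.2 2)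
  have hfin := finite_rows (u := π * x.1.1) hs
  rw [← scaled_eq] at hfin
  obtain ⟨⟨c, d⟩, ⟨hle, hcop⟩, hmin⟩ := Set.exists_min_image
    ({q : O11 × O11 | herm q.1 q.2 (scaled π x) ≤ 1} ∩ {q | IsCoprime (π * q.1) q.2})
    (fun q => herm q.1 q.2 (scaled π x)) (hfin.subset Set.inter_subset_left)
    ⟨(0, 1), by simp [herm], isCoprime_one_right⟩
  obtain ⟨g, h1, h2⟩ := exists_row hcop
  have hg : g ∈ Gamma0 π := ⟨c, h1⟩
  refine ⟨g, hg, (mem_exteriorRegion_den hπ.ne_zero).mpr fun h hh _ => ?_⟩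
  have hgx := den_eq_herm π c d g h1 h2 x
  have hpos := den_pos (toC g) x
  have hmul := toC_mul_den h g x
  obtain ⟨c', hc'⟩ := mul_mem hh hg
  have hhg := den_eq_herm π c' _ (h * g) hc' rfl x
  have hle' : den (toC g) x ≤ den (toC (h * g)) x := by
    rw [hgx, hhg]
    by_cases hlt : herm c' ((h * g) 1 1 : O11) (scaled π x) ≤ 1
    · refine hmin (c', (h * g) 1 1) ⟨hlt, ?_⟩
      change IsCoprime (π * c') ((h * g) 1 1)
      rw [← hc']
      exact isCoprime_row (h * g)
    · exact le_trans hle (not_le.mp hlt).le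
  rw [hmul] at hle'
  exact le_of_mul_le_mul_right (by rwa [one_mul]) hpos

theorem translation_smul_mem_exteriorRegion {π : O11} (hπ : π ≠ 0) {x : H3}
    (hx : x ∈ exteriorRegion π) (β : O11) :
    toPSL (translation β) • x ∈ exteriorRegion π := by
  rw [mem_exteriorRegion_den hπ] at hx ⊢
  intro g hg h0
  have h1 := hx (g * translation β) (mul_mem hg (translation_mem π β).1) (by
    have h00 : translation β 0 0 = 1 := rfl
    have h10 : translation β 1 0 = 0 := rfl
    simpa [Matrix.mul_apply, h00, h10] using h0)
  obtain ⟨-, -, h2, -⟩ := exists_translation (translation_mem π β).2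
  rwa [toC_mul_den, h2, mul_one] at h1

theorem covers_fordDomain {p : ℕ} (hp : p.Prime) (hodd : p ≠ 2) {π : O11} (hπ : Prime π)
    (hdvd : π ∣ (p : O11)) (x : H3) : ∃ g : PGamma0 π, g • x ∈ fordDomain π p := by
  obtain ⟨g, hg, hB⟩ := exists_smul_mem_exteriorRegion hπ x
  obtain ⟨β, hβ⟩ := covers_fundInf hp hodd hπ hdvd (toPSL g • x)
  refine ⟨⟨toPSL (translation β * g),
    ⟨_, mul_mem (translation_mem π β).1 hg, rfl⟩⟩, ?_⟩
  change toPSL (translation β * g) • x ∈ _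
  rw [map_mul, mul_smul]
  exact ⟨translation_smul_mem_exteriorRegion hπ.ne_zero hB β, hβ⟩

/-! ## Translates have disjoint interiors -/

/-- Shrinking moves `h` into the interior of the cell. The half-planes for `l` and `-l` give `|l|² ≤
2(1 - δ) Re(h l̄) ≤ (1 - δ)|l|²`. -/
theorem Hex.eq_zero_of_shrink {h : ℂ} (hh : Hex h) {l : O11} {δ : ℝ} (hδ : 0 < δ) (hδ1 : δ < 1)
    (hl : Hex ((1 - δ : ℝ) * h - l)) : l = 0 := by
  have h1 := hh.two_mul_re_le l
  have h2 := hl.two_mul_re_le (-l)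
  have h3 : (((1 - δ : ℝ) * h - l) * conj ((-l : O11) : ℂ)).re =
      -((1 - δ) * (h * conj (l : ℂ)).re) + Complex.normSq (l : ℂ) := by
    push_cast
    simp [Complex.normSq_apply]
    ring
  rw [h3] at h2
  push_cast at h2
  rw [Complex.normSq_neg] at h2
  by_contra hl0
  have := one_le_normSq hl0
  nlinarith

theorem disjoint_fundInf {p : ℕ} (hp : p.Prime) {π : O11} (hπ : Prime π)
    (hdvd : π ∣ (p : O11)) {γ : PSL2O} (hγ : γ ∈ PGammaInf π) (hγ1 : γ ≠ 1) :
    Disjoint (interior (fundInf π p)) ((fun x => γ • x) '' interior (fundInf π p)) := by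
  have hπ0 := coe_ne_zero hπ.ne_zero
  obtain ⟨g, hg, rfl⟩ := hγ
  obtain ⟨β, hβ, -, hβ0⟩ := exists_translation hg.2
  rw [Set.disjoint_left]
  rintro _ hx ⟨y, hy, rfl⟩
  obtain ⟨x, hxy⟩ : ∃ x, x = toPSL g • y := ⟨_, rfl⟩
  have hxF : x ∈ fundInf π p := hxy ▸ interior_subset hx
  simp only [fundInf, Set.mem_iUnion] at hxF
  obtain ⟨ρ, hρ, hxρ⟩ := hxF
  obtain ⟨r, rfl⟩ := exists_coe_of_mem_representatives hρ
  rw [mem_column hπ.ne_zero] at hxρ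
  -- The preimage `y` is shifted by the displacement that moves `x` towards the centre `r/π` of its
  -- hexagon. For small `δ` it stays in `F_∞`, so `Hex.eq_zero_of_shrink` compares the two hexagons
  -- even when `x` lies on a common boundary.
  let f : ℂ → ℝ → H3 := fun z δ => ⟨(z - δ * (x.1.1 - r / π), x.1.2), x.2⟩
  have hf : ∀ z, Continuous (f z) := fun z => by fun_prop
  have hy0 : f y.1.1 0 = y := Subtype.ext (by
    have := hβ y
    rw [← hxy] at this
    simp [f, this])
  have hev : ∀ᶠ δ in nhds (0 : ℝ), f y.1.1 δ ∈ interior (fundInf π p) :=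
    (hf _).continuousAt.eventually (isOpen_interior.mem_nhds (hy0.symm ▸ hy))
  obtain ⟨s, hs, hball⟩ := Metric.eventually_nhds_iff.mp hev
  set δ := min (s / 2) (1 / 2) with hδ
  have hδ0 : 0 < δ := by positivity
  have hδs : δ < s := (min_le_left _ _).trans_lt (by linarith)
  have hδ1 : δ < 1 := (min_le_right _ _).trans_lt (by norm_num)
  have hyδ := interior_subset (hball (y := δ) (by rwa [Real.dist_eq, sub_zero, abs_of_pos hδ0]))
  simp only [fundInf, Set.mem_iUnion] at hyδ
  obtain ⟨ρ', hρ', hyρ⟩ := hyδ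
  obtain ⟨r', rfl⟩ := exists_coe_of_mem_representatives hρ'
  rw [mem_column hπ.ne_zero] at hyρ
  have hx1 : x.1.1 = y.1.1 + β := hxy ▸ congrArg Prod.fst (hβ y)
  have hl : π * β + r' - r = 0 := by
    apply hxρ.eq_zero_of_shrink hδ0 hδ1
    convert hyρ using 1
    simp only [f, scaled, hx1]
    push_cast
    field_simp
    ring
  have hrr : r = r' := by
    apply representatives_inj hp hπ hdvd hρ hρ'
    exact ⟨β, by linear_combination -hl⟩
  subst hrr
  have : β = 0 := by simpa [hπ.ne_zero] using hl
  exact hγ1 (hβ0 this)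

theorem disjoint_fordDomain {p : ℕ} (hp : p.Prime) {π : O11} (hπ : Prime π)
    (hdvd : π ∣ (p : O11)) {γ : PSL2O} (hγ : γ ∈ PGamma0 π) (hγ1 : γ ≠ 1) :
    Disjoint (interior (fordDomain π p)) ((fun x => γ • x) '' interior (fordDomain π p)) := by
  obtain ⟨g, hg, rfl⟩ := hγ
  by_cases h0 : g 1 0 = 0
  · have hmono : interior (fordDomain π p) ⊆ interior (fundInf π p) :=
      interior_mono Set.inter_subset_right
    exact (disjoint_fundInf hp hπ hdvd ⟨g, ⟨hg, h0⟩, rfl⟩ hγ1).mono hmono (Set.image_mono hmono)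
  rw [Set.disjoint_left]
  rintro _ hx ⟨y, hy, rfl⟩
  have hB : ∀ z ∈ fordDomain π p, ∀ g ∈ Gamma0 π, g 1 0 ≠ 0 → 1 ≤ den (toC g) z :=
    fun z hz => (mem_exteriorRegion_den hπ.ne_zero).mp hz.1
  have h1 := hB _ (interior_subset hy) g hg h0
  have h2 := hB _ (interior_subset hx) g⁻¹ (inv_mem hg)
    (by simpa [Matrix.SpecialLinearGroup.SL2_inv_expl] using h0)
  have h3 := toC_mul_den g⁻¹ g y
  have h4 : den (toC (g⁻¹ * g)) y = 1 := by simp [den]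
  rw [h4] at h3
  -- The values of `den` for `g` at `y` and for `g⁻¹` at `g • y` are both at least `1` and have
  -- product `1`; so `y` lies on the isometric sphere of `g`.
  have h5 : den (toC g) y = 1 := by
    dsimp only at h2
    nlinarith
  -- Lowering `y` slightly keeps it in the interior of `F` but takes it inside that sphere.
  let f : ℝ → H3 := fun δ => ⟨(y.1.1, y.1.2 * Real.exp (-δ)), mul_pos y.2 (Real.exp_pos _)⟩
  have hf : Continuous f := by fun_prop
  have hf0 : f 0 = y := Subtype.ext (by simp [f])
  have hev : ∀ᶠ δ in nhds (0 : ℝ), f δ ∈ interior (fordDomain π p) :=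
    hf.continuousAt.eventually (isOpen_interior.mem_nhds (hf0.symm ▸ hy))
  obtain ⟨s, hs, hball⟩ := Metric.eventually_nhds_iff.mp hev
  have h6 := hB _ (interior_subset (hball (y := s / 2)
    (by rw [Real.dist_eq, sub_zero, abs_of_pos] <;> linarith))) g hg h0
  have h7 : den (toC g) (f (s / 2)) < den (toC g) y := by
    have hc : 0 < Complex.normSq ((toC g) 1 0) := by
      apply Complex.normSq_pos.mpr
      simpa using h0
    have hlt : y.1.2 * Real.exp (-(s / 2)) < y.1.2 :=
      mul_lt_of_lt_one_right y.2 (by rw [← Real.exp_zero]; exact Real.exp_lt_exp.mpr (by linarith))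
    have := pow_lt_pow_left₀ hlt (mul_pos y.2 (Real.exp_pos _)).le two_ne_zero
    simp only [den, f]
    nlinarith
  linarith

theorem isFundamentalRegion_fundInf {p : ℕ} (hp : p.Prime) (hodd : p ≠ 2) {π : O11}
    (hπ : Prime π) (hdvd : π ∣ (p : O11)) :
    IsFundamentalRegion (PGammaInf π) (fundInf π p) where
  closure_interior := closure_interior_fundInf hπ.ne_zero p
  covers x := by
    obtain ⟨β, hβ⟩ := covers_fundInf hp hodd hπ hdvd x
    exact ⟨⟨toPSL (translation β), ⟨_, translation_mem π β, rfl⟩⟩, hβ⟩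
  disjoint g hg := disjoint_fundInf hp hπ hdvd g.2 fun h => hg (Subtype.ext h)

theorem isFundamentalRegion_fordDomain {p : ℕ} (hp : p.Prime) (hodd : p ≠ 2) {π : O11}
    (hπ : Prime π) (hdvd : π ∣ (p : O11)) :
    IsFundamentalRegion (PGamma0 π) (fordDomain π p) where
  closure_interior := closure_interior_fordDomain hπ.ne_zero p
  covers := covers_fordDomain hp hodd hπ hdvd
  disjoint g hg := disjoint_fordDomain hp hπ hdvd g.2 fun h => hg (Subtype.ext h)

end FordDomain

end

theorem mainTheorem11 (p : ℕ) (hp : p.Prime) (hodd : p ≠ 2)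
    (π : FordDomain.O11) (hπ : Prime π) (hdvd : π ∣ (p : FordDomain.O11)) :
    -- the visible spheres
    FordDomain.visibleSpheres π =
        {S | ∃ α : FordDomain.O11, ¬ π ∣ α ∧
          S = FordDomain.hemisphere ((α : ℂ) / (π : ℂ)) (1 / ‖(π : ℂ)‖)} ∪
        {S | ∃ β : FordDomain.O11, ∃ c ∈ FordDomain.smallCenters π,
          S = FordDomain.hemisphere (c + (β : ℂ)) (FordDomain.smallRadius π)} ∧
    -- they suffice to determine the exterior region
    FordDomain.exteriorRegion π =
        {x | (∀ α : FordDomain.O11, ¬ π ∣ α →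
            x ∈ FordDomain.outside ((α : ℂ) / (π : ℂ)) (1 / ‖(π : ℂ)‖)) ∧
          ∀ β : FordDomain.O11, ∀ c ∈ FordDomain.smallCenters π,
            x ∈ FordDomain.outside (c + (β : ℂ)) (FordDomain.smallRadius π)} ∧
    -- the small visible spheres whose boundary circle passes through the cusp `0`
    {c : ℂ | FordDomain.hemisphere c (FordDomain.smallRadius π) ∈ FordDomain.visibleSpheres π ∧
        ‖c‖ = FordDomain.smallRadius π} = FordDomain.smallCenters π ∧
    -- the vertices of the exterior region
    FordDomain.vertices (FordDomain.exteriorRegion π) =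
        {x | ∃ α : FordDomain.O11, ∃ z ∈ FordDomain.sixPoints,
          x.1 = ((z + (α : ℂ)) / (π : ℂ), FordDomain.height π)} ∧
    -- representatives of the large visible spheres modulo the stabilizer of `∞`
    (∀ α : FordDomain.O11, ¬ π ∣ α →
      ∃! ρ : ℂ, ρ ∈ FordDomain.representatives p ∧ ρ ≠ 0 ∧
        ∃ γ ∈ FordDomain.PGammaInf π,
          (fun x : FordDomain.H3 => γ • x) ''
              FordDomain.hemisphere ((α : ℂ) / (π : ℂ)) (1 / ‖(π : ℂ)‖) =
            FordDomain.hemisphere (ρ / (π : ℂ)) (1 / ‖(π : ℂ)‖)) ∧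
    -- the fundamental domains for the stabilizer of `∞` and for the whole group
    FordDomain.IsFundamentalRegion (FordDomain.PGammaInf π) (FordDomain.fundInf π p) ∧
    FordDomain.IsFundamentalRegion (FordDomain.PGamma0 π) (FordDomain.fordDomain π p) ∧
    -- the isometric spheres bounding the Ford domain
    FordDomain.faceSpheres π (FordDomain.fordDomain π p) =
        {S | ∃ ρ ∈ FordDomain.representatives p, ρ ≠ 0 ∧
          S = FordDomain.hemisphere (ρ / (π : ℂ)) (1 / ‖(π : ℂ)‖)} ∪
        {S | ∃ c ∈ FordDomain.smallCenters π,
          S = FordDomain.hemisphere c (FordDomain.smallRadius π)} ∧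
    -- its vertices, and its description by convex hulls of vertices and cusps
    FordDomain.vertices (FordDomain.exteriorRegion π) ∩ FordDomain.fordDomain π p =
        {x | ∃ ρ ∈ FordDomain.representatives p, ∃ z ∈ FordDomain.sixPoints,
          x.1 = ((z + ρ) / (π : ℂ), FordDomain.height π)} ∧
    FordDomain.fordDomain π p =
        ⋃ ρ ∈ FordDomain.representatives p,
          FordDomain.hullWithInfty (FordDomain.cellVertices π ρ) := by
  open FordDomain in
  exact ⟨visibleSpheres_eq hπ, exteriorRegion_eq hπ, smallCenters_eq hπ, vertices_eq hπ,
    fun α hα => existsUnique_representative hp hodd hπ hdvd hα,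
    isFundamentalRegion_fundInf hp hodd hπ hdvd, isFundamentalRegion_fordDomain hp hodd hπ hdvd,
    faceSpheres_fordDomain hp hodd hπ hdvd, vertices_inter_fordDomain hπ,
    fordDomain_eq_hulls hp hπ hdvd⟩
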